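/- For a map $f:X\to Y$ between metric spaces and $x\in X$, let $|\nabla f(x)|_\infty=\sup_{y\in X\setminus\{x\}}\frac{d_Y(f(x),f(y))}{d_X(x,y)}\in[0,\infty]$ (with $\sup\emptyset=0$) be the maximum gradient of $f$ at $x$; $f$ is non-contractive if $d_Y(f(x),f(y))\ge d_X(x,y)$ for all $x,y\in X$. In a distribution $\mathscr D$ over non-contractive embeddings $f:X\to Y$, both the target $Y$ and the map $f$ are random, and each distance $d_Y(f(x),f(y))$ is a random variable. A tree metric is the shortest-path metric on the vertex set of a graph-theoretical tree with positively weighted edges. There is a universal constant $C>0$ such that for every finite metric space $X$ with $n$ points there is a distribution $\mathscr D$ over non-contractive embeddings $f:X\to U$ into ultrametric spaces such that for every $x\in X$, $$\mathbb E_{\mathscr D}\left[|\nabla f(x)|_\infty\right]\le C(\log n)^2 .$$ Conversely, let $G_1$ be the cycle of length $4$ and let $G_{k+1}$ be obtained from $G_k$ by replacing every edge $\{a,b\}$ by a quadrilateral, i.e. by deleting the edge and adding two new vertices, each joined to both $a$ and $b$ (the diamond graphs), and equip the vertex set of $G_k$ with its unweighted shortest-path metric. Then $G_k$ has $n_k=\frac{2\cdot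 4^k+4}{3}$ vertices, and there is a universal constant $c>0$ such that for every $k\ge1$ and every distribution $\mathscr D$ over non-contractive embeddings $f:G_k\to T$ into tree metrics there is a vertex $x$ of $G_k$ with $$\mathbb E_{\mathscr D}\left[|\nabla f(x)|_\infty\right]\ge c(\log n_k)^2 .$$ -/

import Mathlib

open MeasureTheory
open scoped ENNReal

universe u v w

/-- A map between metric spaces is non-contractive if it does not decrease distances. -/
def NonContractive {X : Type u} {Y : Type v} [MetricSpace X] [MetricSpace Y] (f : X → Y) : Prop :=
  ∀ x y : X, dist x y ≤ dist (f x) (f y)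

/-- The maximum gradient of `f` at `x`: the supremum over `y ≠ x` of
`d(f x, f y) / d(x, y)`, with values in `[0, ∞]`. -/
noncomputable def maxGradient {X : Type u} {Y : Type v} [MetricSpace X] [MetricSpace Y]
    (f : X → Y) (x : X) : ℝ≥0∞ :=
  ⨆ y : X, ⨆ _ : y ≠ x, edist (f x) (f y) / edist x y

/-- The total weight of a walk, for a weight function on edges. -/
def walkWeight {V : Type u} {G : SimpleGraph V} (wt : Sym2 V → ℝ) {a b : V}
    (p : G.Walk a b) : ℝ :=
  (p.edges.map wt).sum

/-- `T` carries a tree metric: it is the vertex set of a graph-theoretical tree with (positively)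
weighted edges, and its distance is the shortest-path distance. -/
def IsTreeMetric (T : Type v) [MetricSpace T] : Prop :=
  ∃ (G : SimpleGraph T) (wt : Sym2 T → ℝ), G.IsTree ∧ (∀ e ∈ G.edgeSet, 0 < wt e) ∧
    ∀ a b : T, IsLeast (Set.range fun p : G.Walk a b => walkWeight wt p) (dist a b)

/-- `T` carries an ultrametric. -/
def IsUltrametric (T : Type v) [MetricSpace T] : Prop :=
  ∀ a b c : T, dist a b ≤ max (dist a c) (dist c b)

/-- A distribution over non-contractive embeddings of `X` into metric spaces of the class `P`:
both the target space and the map depend on a sample point `ω` of a probability space, and the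
random distances `d(f x, f y)` are random variables. -/
structure RandomEmbedding (X : Type u) [MetricSpace X]
    (P : ∀ (T : Type v) [MetricSpace T], Prop) where
  /-- the sample space -/
  Ω : Type w
  [measurableSpace : MeasurableSpace Ω]
  /-- the probability measure -/
  prob : Measure Ω
  [isProbabilityMeasure : IsProbabilityMeasure prob]
  /-- the random target space -/
  Target : Ω → Type v
  [metric : ∀ ω, MetricSpace (Target ω)]
  /-- the random map -/
  map : ∀ ω, X → Target ω
  target_mem : ∀ ω, P (Target ω)
  nonContractive : ∀ ω, NonContractive (map ω)
  measurable_dist : ∀ x y : X, Measurable fun ω => dist (map ω x) (map ω y)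

attribute [instance] RandomEmbedding.measurableSpace RandomEmbedding.isProbabilityMeasure
  RandomEmbedding.metric

/-- The expected maximum gradient at `x`, with values in `[0, ∞]`. -/
noncomputable def RandomEmbedding.expectedMaxGradient {X : Type u} [MetricSpace X]
    {P : ∀ (T : Type v) [MetricSpace T], Prop} (F : RandomEmbedding.{u, v, w} X P) (x : X) :
    ℝ≥0∞ :=
  ∫⁻ ω, maxGradient (F.map ω) x ∂F.prob

/-- The adjacency relation of the graph obtained from `G` by replacing every edge by a
quadrilateral: see `quadReplace`. -/
def quadReplaceAdj {V : Type u} (G : SimpleGraph V) :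
    V ⊕ (G.edgeSet × Bool) → V ⊕ (G.edgeSet × Bool) → Prop
  | Sum.inl a, Sum.inr (e, _) => a ∈ e.1
  | Sum.inr (e, _), Sum.inl a => a ∈ e.1
  | Sum.inl _, Sum.inl _ => False
  | Sum.inr _, Sum.inr _ => False

/-- The graph obtained from `G` by replacing every edge `e = {a, b}` by a quadrilateral
`a, (e, false), b, (e, true)`, where `(e, false)` and `(e, true)` are two new vertices. -/
def quadReplace {V : Type u} (G : SimpleGraph V) : SimpleGraph (V ⊕ (G.edgeSet × Bool)) where
  Adj := quadReplaceAdj G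
  symm := ⟨by
    rintro (a | ⟨e, i⟩) (b | ⟨e', j⟩) h
    · exact h
    · exact h
    · exact h
    · exact h⟩
  loopless := ⟨by
    rintro (a | ⟨e, i⟩) h
    · exact h
    · exact h⟩

/-- The diamond graphs with their vertex sets: `G₀` is a single edge (so that `G₁` is a cycle of
length four) and `Gₖ₊₁` is obtained from `Gₖ` by replacing every edge by a quadrilateral. -/
def diamondAux : ℕ → (V : Type) × SimpleGraph V
  | 0 => ⟨Bool, ⊤⟩
  | k + 1 => ⟨_, quadReplace (diamondAux k).2⟩

/-- The vertex set of the `k`-th diamond graph. -/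
def DiamondVertex (k : ℕ) : Type := (diamondAux k).1

/-- The `k`-th diamond graph. -/
def diamondGraph (k : ℕ) : SimpleGraph (DiamondVertex k) := (diamondAux k).2

theorem quadReplace_connected {V : Type u} {G : SimpleGraph V} (hG : G.Connected) :
    (quadReplace G).Connected := by
  have key : ∀ a b : V, (quadReplace G).Reachable (Sum.inl a) (Sum.inl b) := by
    intro a b
    obtain ⟨p⟩ := hG.preconnected a b
    induction p with
    | nil => exact SimpleGraph.Reachable.refl _
    | @cons x y z h p ih =>
      have h1 : (quadReplace G).Adj (Sum.inl x) (Sum.inr (⟨s(x, y), h⟩, true)) :=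
        Sym2.mem_mk_left x y
      have h2 : (quadReplace G).Adj (Sum.inr (⟨s(x, y), h⟩, true)) (Sum.inl y) :=
        Sym2.mem_mk_right x y
      exact (h1.reachable.trans h2.reachable).trans ih
  have key2 : ∀ q : V ⊕ (G.edgeSet × Bool), ∃ a : V,
      (quadReplace G).Reachable q (Sum.inl a) := by
    rintro (a | ⟨⟨e, he⟩, i⟩)
    · exact ⟨a, SimpleGraph.Reachable.refl _⟩
    · induction e with
      | h x y =>
        have h1 : (quadReplace G).Adj (Sum.inr (⟨s(x, y), he⟩, i)) (Sum.inl x) :=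
          Sym2.mem_mk_left x y
        exact ⟨x, h1.reachable⟩
  have : Nonempty V := hG.nonempty
  refine (SimpleGraph.connected_iff _).2 ⟨fun p q => ?_, inferInstance⟩
  obtain ⟨a, ha⟩ := key2 p
  obtain ⟨b, hb⟩ := key2 q
  exact (ha.trans (key a b)).trans hb.symm

theorem diamondGraph_connected (k : ℕ) : (diamondGraph k).Connected := by
  induction k with
  | zero => exact SimpleGraph.connected_top (V := Bool)
  | succ k ih => exact quadReplace_connected ih

/-- The `k`-th diamond graph as a metric space, with its (unweighted) shortest-path metric. -/
noncomputable instance (k : ℕ) : MetricSpace (DiamondVertex k) where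
  dist a b := ((diamondGraph k).dist a b : ℝ)
  dist_self a := by simp
  dist_comm a b := by rw [SimpleGraph.dist_comm]
  dist_triangle a b c := by exact_mod_cast (diamondGraph_connected k).dist_triangle
  eq_of_dist_eq_zero {a b} h :=
    (diamondGraph_connected k).dist_eq_zero_iff.1 (by exact_mod_cast h)

/-! Lower bound. A quadrilateral of level `i` in the `k`-th diamond graph has opposite sides at
distance `2 ^ n`, where `n = k - i - 1`. If all four sides were spanned by chains whose steps have
images shorter than `2 ^ n`, a median in the tree would force two opposite sides to have images
closer than `2 ^ n`, against non-contraction (`exists_opposite_close`, `exists_not_isConnectedBy`).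
So on some side every route uses a stretched edge. A side is a series-parallel graph, and cutting it
means cutting one half of each of two parallel routes, recursively. The stretched edges of level `i
+ a` therefore contain a binary cut of density `2 ^ (-(a + 1))`, and the vertices below it have
gradient at least `2 ^ (a - 2)` (`exists_cut`, `le_maxGradient_of_isAllowed`). Cuts that start at
different levels overlap little, so `m` levels together have density at least `m * 2 ^ (-(a + 3))`
(`card_exists_isAllowed_ge`). Each of the `m` exponents `a` in `m + 1, ..., 2 * m` thus contributes
order `m` to the average gradient over edges. With `m` of order `k`, that is of order `log n`, the
average has order `(log n) ^ 2`, and some vertex attains it in expectation.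

Upper bound. Take a random ordering of `X` and one random factor `1 + i / 2 ^ J` shared by all
scales `k`. At scale `k` each point joins the first centre within `(1 + i / 2 ^ J) * 2 ^ (k - 2)`;
points at distance at least `2 ^ k` are then separated, so the resulting ultrametric does not
contract. A stretch of about `2 ^ j` at `x` requires a point `z` whose distance from `x` is within a
relative error of order `2 ^ (-j)` of a radius, and which precedes all points at least as near to
`x` (`exists_first_of_center_ne`). Because the factor is shared, the first event has probability
`O(2 ^ (-j))` over all scales at once; independently, the second has probability at most the inverse
size of a ball. Summing over `z` gives a harmonic number (`card_isCutAt_le`), so each dyadic stretch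
contributes `O(log n)`. Restricting to `goodRadii`, at least half of all factors, excludes `j ≥ J`,
and `J = O(log n)`. -/

/-! ### Trees -/

/-- Every walk from `x` to `y` passes through `m`. -/
def SimpleGraph.Separates {V : Type u} (G : SimpleGraph V) (x m y : V) : Prop :=
  ∀ p : G.Walk x y, m ∈ p.support

namespace SimpleGraph.Separates

variable {V : Type u} {G : SimpleGraph V}

theorem left (x y : V) : G.Separates x x y := fun p => p.start_mem_support

theorem right (x y : V) : G.Separates x y y := fun p => p.end_mem_support

theorem symm {x m y : V} (h : G.Separates x m y) : G.Separates y m x := fun p => by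
  simpa using h p.reverse

theorem or_of_mid {x m y : V} (h : G.Separates x m y) (z : V) :
    G.Separates x m z ∨ G.Separates z m y := by
  by_contra! hc
  simp only [Separates, not_forall] at hc
  obtain ⟨⟨p, hp⟩, q, hq⟩ := hc
  have := h (p.append q)
  rw [Walk.mem_support_append_iff] at this
  tauto

end SimpleGraph.Separates

/-- If `z`, `z'` are adjacent in an acyclic graph and `y` lies on the side of `z'`, then `z'`
separates `z` from `y`. -/
theorem SimpleGraph.IsAcyclic.separates_of_adj {V : Type u} {G : SimpleGraph V}
    (hG : G.IsAcyclic) {z z' y : V} (h : G.Adj z z') (hy : ¬ G.Separates y z z') :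
    G.Separates z z' y := by
  classical
  simp only [Separates, not_forall] at hy
  obtain ⟨p, hp⟩ := hy
  intro q
  by_contra hq
  have hpath : (Walk.cons h.symm q.bypass).IsPath := by
    rw [Walk.cons_isPath_iff]
    exact ⟨q.bypass_isPath, fun h' => hq (q.support_bypass_subset_support h')⟩
  have heq := (hG.subsingleton_path z' y).elim ⟨_, hpath⟩ ⟨_, p.reverse.bypass_isPath⟩
  have hz : z ∈ (Walk.cons h.symm q.bypass).support := by simp
  have heq' : Walk.cons h.symm q.bypass = p.reverse.bypass := congrArg Subtype.val heq
  rw [heq'] at hz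
  exact hp (by simpa using p.reverse.support_bypass_subset_support hz)

/-- Three vertices of a tree have a median. -/
theorem SimpleGraph.IsTree.exists_median {V : Type u} {G : SimpleGraph V} (hG : G.IsTree)
    (x y z : V) :
    ∃ m, G.Separates x m y ∧ G.Separates y m z ∧ G.Separates x m z := by
  classical
  obtain ⟨p⟩ := hG.connected.preconnected z x
  induction p with
  | nil => exact ⟨_, .left _ _, .right _ _, .left _ _⟩
  | @cons z' z x h p ih =>
    obtain ⟨m, hxy, hyz, hxz⟩ := ih
    by_cases hm : m = z
    · subst hm
      -- The old median `z` fails only if `x` or `y` lies beyond `z'`. Then every walk from `x` to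
      -- `y`, which passes `z`, also passes `z'`, and `z'` is the new median.
      by_cases hy : G.Separates y m z'
      · by_cases hx : G.Separates x m z'
        · exact ⟨m, hxy, hy, hx⟩
        · refine ⟨z', fun q => ?_, .right _ _, .right _ _⟩
          have h1 := (hG.isAcyclic.separates_of_adj h.symm hx).symm (q.takeUntil m (hxy q))
          exact q.support_takeUntil_subset_support (hxy q) h1
      · refine ⟨z', fun q => ?_, .right _ _, .right _ _⟩
        have h1 := hG.isAcyclic.separates_of_adj h.symm hy (q.dropUntil m (hxy q))
        exact q.support_dropUntil_subset_support (hxy q) h1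
    · have key : ∀ {t}, G.Separates t m z → G.Separates t m z' := fun ht q => by
        have := ht (q.concat h)
        rw [Walk.support_concat] at this
        simpa [hm] using this
      exact ⟨m, hxy, key hyz, key hxz⟩

/-- Separating vertices lie metrically between the vertices that they separate. -/
theorem dist_add_dist_le_of_separates {T : Type v} [MetricSpace T] {G : SimpleGraph T}
    {wt : Sym2 T → ℝ}
    (hd : ∀ a b : T, IsLeast (Set.range fun p : G.Walk a b => walkWeight wt p) (dist a b))
    {a m b : T} (h : G.Separates a m b) : dist a m + dist m b ≤ dist a b := by
  classical
  obtain ⟨p, hp⟩ := (hd a b).1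
  have h1 : dist a m ≤ walkWeight wt (p.takeUntil m (h p)) := (hd a m).2 ⟨_, rfl⟩
  have h2 : dist m b ≤ walkWeight wt (p.dropUntil m (h p)) := (hd m b).2 ⟨_, rfl⟩
  have h3 : walkWeight wt p =
      walkWeight wt (p.takeUntil m (h p)) + walkWeight wt (p.dropUntil m (h p)) := by
    rw [walkWeight, walkWeight, walkWeight, ← List.sum_append, ← List.map_append,
      ← SimpleGraph.Walk.edges_append, p.take_spec]
  have h4 : walkWeight wt p = dist a b := hp
  linarith

/-- A chain with steps shorter than `D` that is separated by `q` comes within `D / 2` of `q`. -/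
theorem exists_dist_lt_of_chain {V : Type u} {T : Type v} [MetricSpace T] {G : SimpleGraph T}
    {wt : Sym2 T → ℝ}
    (hd : ∀ a b : T, IsLeast (Set.range fun p : G.Walk a b => walkWeight wt p) (dist a b))
    {f : V → T} {S : Set V} {D : ℝ} (hD : 0 < D) {a b : V} {q : T} (ha : a ∈ S)
    (hc : Relation.ReflTransGen (fun x y => x ∈ S ∧ y ∈ S ∧ dist (f x) (f y) < D) a b)
    (hq : G.Separates (f a) q (f b)) : ∃ x ∈ S, dist (f x) q < D / 2 := by
  induction hc with
  | refl =>
    refine ⟨a, ha, ?_⟩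
    have := dist_add_dist_le_of_separates hd hq
    rw [dist_self, dist_comm q] at this
    linarith
  | @tail x y _ hxy ih =>
    obtain ⟨hx, hy, hlt⟩ := hxy
    -- Either `q` already separates the ends of the shorter chain, or it lies between the ends of
    -- the last step.
    rcases hq.or_of_mid (f x) with h | h
    · exact ih h
    · have := dist_add_dist_le_of_separates hd h
      rw [dist_comm q] at this
      by_cases h' : dist (f x) q < D / 2
      · exact ⟨x, hx, h'⟩
      · exact ⟨y, hy, by linarith⟩

/-- In a quadrilateral of chains with steps shorter than `D` in a tree metric, some two opposite
sides come within distance `D`. -/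
theorem IsTreeMetric.exists_opposite_close {V : Type u} {T : Type v} [MetricSpace T]
    (hT : IsTreeMetric T) {f : V → T} {D : ℝ} (hD : 0 < D) {a b c d : V}
    {S₁ S₂ S₃ S₄ : Set V} (h₁ : a ∈ S₁) (h₂ : b ∈ S₂) (h₃ : a ∈ S₃) (h₄ : d ∈ S₄)
    (hab : Relation.ReflTransGen (fun x y => x ∈ S₁ ∧ y ∈ S₁ ∧ dist (f x) (f y) < D) a b)
    (hbc : Relation.ReflTransGen (fun x y => x ∈ S₂ ∧ y ∈ S₂ ∧ dist (f x) (f y) < D) b c)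
    (had : Relation.ReflTransGen (fun x y => x ∈ S₃ ∧ y ∈ S₃ ∧ dist (f x) (f y) < D) a d)
    (hdc : Relation.ReflTransGen (fun x y => x ∈ S₄ ∧ y ∈ S₄ ∧ dist (f x) (f y) < D) d c) :
    (∃ x ∈ S₁, ∃ y ∈ S₄, dist (f x) (f y) < D) ∨ (∃ x ∈ S₂, ∃ y ∈ S₃, dist (f x) (f y) < D) := by
  obtain ⟨G, wt, hG, -, hd⟩ := hT
  have close : ∀ {x y q : T}, dist x q < D / 2 → dist y q < D / 2 → dist x y < D :=
    fun {x y q} hx hy => by linarith [dist_triangle_right x y q]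
  -- The chains `ab` and `bc` both pass near the median, and so does `ad` or `dc`, since `m`
  -- separates `f a` from `f c`. Whichever it is, its opposite side is `bc` or `ab`.
  obtain ⟨m, hmab, hmbc, hmac⟩ := hG.exists_median (f a) (f b) (f c)
  rcases hmac.or_of_mid (f d) with h | h
  · obtain ⟨x, hx, hxm⟩ := exists_dist_lt_of_chain hd hD h₂ hbc hmbc
    obtain ⟨y, hy, hym⟩ := exists_dist_lt_of_chain hd hD h₃ had h
    exact Or.inr ⟨x, hx, y, hy, close hxm hym⟩
  · obtain ⟨x, hx, hxm⟩ := exists_dist_lt_of_chain hd hD h₁ hab hmab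
    obtain ⟨y, hy, hym⟩ := exists_dist_lt_of_chain hd hD h₄ hdc h
    exact Or.inl ⟨x, hx, y, hy, close hxm hym⟩

/-! ### Addresses in diamond graphs -/

/-- `x` is an end of an edge whose address (of length at most `k`) extends `c`. -/
def addressRegion {V : Type u} (e : List (Bool × Bool) → V × V) (k : ℕ) (c : List (Bool × Bool)) :
    Set V :=
  {x | ∃ v, c <:+ v ∧ v.length ≤ k ∧ (x = (e v).1 ∨ x = (e v).2)}

/-- `e` assigns to every address of length at most `k` an ordered pair of vertices, in such a way
that the pair with address `w` is the pair of poles of a quadrilateral whose sides have the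
addresses `(b, c) :: w`: the side `(b, false)` leads from the first pole to a midpoint, the side
`(b, true)` from this midpoint to the second pole. Addresses of length `k` are edges of `G`. -/
structure IsDiamondAddressing {V : Type u} (G : SimpleGraph V) (k : ℕ)
    (e : List (Bool × Bool) → V × V) : Prop where
  fst : ∀ w, w.length < k → ∀ b, (e ((b, false) :: w)).1 = (e w).1
  snd : ∀ w, w.length < k → ∀ b, (e ((b, true) :: w)).2 = (e w).2
  mid : ∀ w, w.length < k → ∀ b, (e ((b, false) :: w)).2 = (e ((b, true) :: w)).1
  adj : ∀ w, w.length = k → G.Adj (e w).1 (e w).2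
  opposite : ∀ w n, w.length + n + 1 = k → ∀ b c, ∃ φ : V → ℤ,
    (∀ x y, G.Adj x y → |φ x - φ y| ≤ 1) ∧
    (∀ x ∈ addressRegion e k ((b, c) :: w), φ x = 0) ∧
    (∀ x ∈ addressRegion e k ((!b, !c) :: w), φ x = 2 ^ n)

/-- The refinement of an integer-valued function along `quadReplace`. -/
def refineFun {V : Type u} (G : SimpleGraph V) (φ : V → ℤ) : V ⊕ (G.edgeSet × Bool) → ℤ
  | Sum.inl a => 2 * φ a
  | Sum.inr (e, _) => Sym2.lift ⟨fun a b => φ a + φ b, fun _ _ => add_comm _ _⟩ e.1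

theorem refineFun_lipschitz {V : Type u} {G : SimpleGraph V} {φ : V → ℤ}
    (hφ : ∀ x y, G.Adj x y → |φ x - φ y| ≤ 1) (x y) (h : (quadReplace G).Adj x y) :
    |refineFun G φ x - refineFun G φ y| ≤ 1 := by
  have key : ∀ (a : V) (e : G.edgeSet) (i : Bool), a ∈ e.1 →
      |refineFun G φ (Sum.inl a) - refineFun G φ (Sum.inr (e, i))| ≤ 1 := by
    rintro a ⟨e, he⟩ i ha
    obtain ⟨b, rfl⟩ := ha
    have := hφ a b he
    simp only [refineFun, Sym2.lift_mk]
    rwa [show 2 * φ a - (φ a + φ b) = φ a - φ b by ring]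
  rcases x with a | ⟨e, i⟩ <;> rcases y with b | ⟨e', j⟩
  · exact h.elim
  · exact key a e' j h
  · rw [abs_sub_comm]; exact key b e i h
  · exact h.elim

open Classical in
/-- The addressing of `quadReplace G` that extends an addressing of `G` by one level. -/
noncomputable def extendAddressing {V : Type u} (G : SimpleGraph V) (k : ℕ)
    (e : List (Bool × Bool) → V × V) :
    List (Bool × Bool) → (V ⊕ (G.edgeSet × Bool)) × (V ⊕ (G.edgeSet × Bool))
  | [] => (Sum.inl (e []).1, Sum.inl (e []).2)
  | (b, c) :: w =>
    if w.length < k then (Sum.inl (e ((b, c) :: w)).1, Sum.inl (e ((b, c) :: w)).2)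
    else if h : G.Adj (e w).1 (e w).2 then
      bif c then (Sum.inr (⟨s((e w).1, (e w).2), h⟩, b), Sum.inl (e w).2)
      else (Sum.inl (e w).1, Sum.inr (⟨s((e w).1, (e w).2), h⟩, b))
    -- A junk value: addresses `w` of length `k` are edges, and longer `w` are never used.
    else (Sum.inl (e []).1, Sum.inl (e []).2)

theorem extendAddressing_of_le {V : Type u} (G : SimpleGraph V) {k : ℕ}
    (e : List (Bool × Bool) → V × V) {w : List (Bool × Bool)} (hw : w.length ≤ k) :
    extendAddressing G k e w = (Sum.inl (e w).1, Sum.inl (e w).2) := by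
  rcases w with _ | ⟨⟨b, c⟩, w⟩
  · rfl
  · simp only [List.length_cons] at hw
    simp [extendAddressing, show w.length < k by omega]

theorem extendAddressing_of_eq {V : Type u} (G : SimpleGraph V) {k : ℕ}
    (e : List (Bool × Bool) → V × V) {w : List (Bool × Bool)} (hw : w.length = k)
    (h : G.Adj (e w).1 (e w).2) (b c : Bool) :
    extendAddressing G k e ((b, c) :: w) =
      bif c then (Sum.inr (⟨s((e w).1, (e w).2), h⟩, b), Sum.inl (e w).2)
      else (Sum.inl (e w).1, Sum.inr (⟨s((e w).1, (e w).2), h⟩, b)) := by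
  simp [extendAddressing, hw, h]

/-- The point is `opposite`. In a newly created quadrilateral opposite sides are disjoint edges,
separated by a function with values 0 and 1. In an older one `refineFun` doubles the separating
function and stays 1-Lipschitz, because a new vertex receives the sum of the values at its two
neighbours. -/
theorem IsDiamondAddressing.extend {V : Type u} {G : SimpleGraph V} {k : ℕ}
    {e : List (Bool × Bool) → V × V} (he : IsDiamondAddressing G k e) :
    IsDiamondAddressing (quadReplace G) (k + 1) (extendAddressing G k e) where
  fst w hw b := by
    rcases Nat.lt_succ_iff_lt_or_eq.1 hw with h | h
    · rw [extendAddressing_of_le G e (by simpa using h), extendAddressing_of_le G e h.le,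
        he.fst w h]
    · rw [extendAddressing_of_eq G e h (he.adj w h), extendAddressing_of_le G e h.le]
      rfl
  snd w hw b := by
    rcases Nat.lt_succ_iff_lt_or_eq.1 hw with h | h
    · rw [extendAddressing_of_le G e (by simpa using h), extendAddressing_of_le G e h.le,
        he.snd w h]
    · rw [extendAddressing_of_eq G e h (he.adj w h), extendAddressing_of_le G e h.le]
      rfl
  mid w hw b := by
    rcases Nat.lt_succ_iff_lt_or_eq.1 hw with h | h
    · rw [extendAddressing_of_le G e (by simpa using h),
        extendAddressing_of_le G e (by simpa using h), he.mid w h]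
    · rw [extendAddressing_of_eq G e h (he.adj w h), extendAddressing_of_eq G e h (he.adj w h)]
      rfl
  adj w hw := by
    rcases w with _ | ⟨⟨b, c⟩, w⟩
    · simp at hw
    · have h : w.length = k := by simpa using hw
      rw [extendAddressing_of_eq G e h (he.adj w h)]
      cases c
      · exact Sym2.mem_mk_left _ _
      · exact Sym2.mem_mk_right _ _
  opposite w n hn b c := by
    classical
    rcases n with _ | n
    · have hw : w.length = k := by omega
      have hadj := he.adj w hw
      have hmem : ∀ b c x, x ∈ addressRegion (extendAddressing G k e) (k + 1) ((b, c) :: w) →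
          x = (extendAddressing G k e ((b, c) :: w)).1 ∨
            x = (extendAddressing G k e ((b, c) :: w)).2 := by
        rintro b c x ⟨v, hv, hvk, hx⟩
        have : (b, c) :: w = v := hv.eq_of_length_le (by simp; omega)
        rwa [← this] at hx
      refine ⟨fun x => if x = (extendAddressing G k e ((b, c) :: w)).1 ∨
            x = (extendAddressing G k e ((b, c) :: w)).2 then 0 else 1, fun x y _ => ?_,
          fun x hx => if_pos (hmem b c x hx), fun x hx => ?_⟩
      · dsimp only
        split_ifs <;> simp
      · dsimp only
        rw [if_neg, pow_zero]
        have h1 := hadj.ne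
        have h2 := hadj.ne.symm
        have hx' := hmem _ _ x hx
        rw [extendAddressing_of_eq G e hw hadj] at hx' ⊢
        cases b <;> cases c <;> rcases hx' with rfl | rfl <;> simp [h1, h2]
    · obtain ⟨φ, hφ, h0, h1⟩ := he.opposite w n (by omega) b c
      have key : ∀ b c (t : ℤ), (∀ x ∈ addressRegion e k ((b, c) :: w), φ x = t) →
          ∀ x ∈ addressRegion (extendAddressing G k e) (k + 1) ((b, c) :: w),
            refineFun G φ x = 2 * t := by
        rintro b c t ht x ⟨v, hv, hvk, hx⟩
        rcases hvk.lt_or_eq with hlt | heq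
        · have hle : v.length ≤ k := by omega
          rw [extendAddressing_of_le G e hle] at hx
          rcases hx with rfl | rfl
          · simp [refineFun, ht _ ⟨v, hv, hle, Or.inl rfl⟩]
          · simp [refineFun, ht _ ⟨v, hv, hle, Or.inr rfl⟩]
        · rcases v with _ | ⟨⟨b', c'⟩, v⟩
          · simp at heq
          have hvk' : v.length = k := by simpa using heq
          have hv' : (b, c) :: w <:+ v := by
            rcases List.suffix_cons_iff.1 hv with h | h
            · have := congrArg List.length h
              simp at this
              omega
            · exact h
          have t1 := ht _ ⟨v, hv', hvk'.le, Or.inl rfl⟩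
          have t2 := ht _ ⟨v, hv', hvk'.le, Or.inr rfl⟩
          rw [extendAddressing_of_eq G e hvk' (he.adj v hvk')] at hx
          cases c' <;> rcases hx with rfl | rfl <;> simp [refineFun, t1, t2, two_mul]
      refine ⟨refineFun G φ, refineFun_lipschitz hφ, fun x hx => ?_, fun x hx => ?_⟩
      · simpa using key b c 0 h0 x hx
      · rw [key _ _ _ h1 x hx, pow_succ']

/-- The diamond graphs have addressings. -/
theorem exists_isDiamondAddressing (k : ℕ) :
    ∃ e, IsDiamondAddressing (diamondGraph k) k e := by
  induction k with
  | zero =>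
    refine ⟨fun _ => (false, true), fun w hw => by simp at hw, fun w hw => by simp at hw,
      fun w hw => by simp at hw, fun w _ => ?_, fun w n hn => by omega⟩
    exact show (false : Bool) ≠ true by decide
  | succ k ih =>
    obtain ⟨e, he⟩ := ih
    exact ⟨_, he.extend⟩

/-! ### Distances -/

/-- This turns the functions of `IsDiamondAddressing.opposite` into lower bounds for distances. -/
theorem abs_sub_le_dist_of_lipschitz {k : ℕ} {φ : DiamondVertex k → ℤ}
    (hφ : ∀ x y, (diamondGraph k).Adj x y → |φ x - φ y| ≤ 1) (x y : DiamondVertex k) :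
    (|φ x - φ y| : ℝ) ≤ dist x y := by
  obtain ⟨p, hp⟩ := (diamondGraph_connected k).exists_walk_length_eq_dist x y
  have hd : dist x y = (p.length : ℝ) := by rw [hp]; rfl
  rw [hd]
  have : |φ x - φ y| ≤ p.length := by
    clear hd hp
    induction p with
    | nil => simp
    | @cons a b c h p ih =>
      have := abs_sub_le (φ a) (φ b) (φ c)
      have := hφ _ _ h
      simp only [SimpleGraph.Walk.length_cons, Nat.cast_add, Nat.cast_one]
      omega
  exact_mod_cast this

theorem DiamondVertex.dist_eq_one {k : ℕ} {x y : DiamondVertex k} (h : (diamondGraph k).Adj x y) :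
    dist x y = 1 := by
  have : (diamondGraph k).dist x y = 1 := SimpleGraph.dist_eq_one_iff_adj.2 h
  change ((diamondGraph k).dist x y : ℝ) = 1
  simp [this]

namespace IsDiamondAddressing

variable {k : ℕ} {e : List (Bool × Bool) → DiamondVertex k × DiamondVertex k}

theorem le_dist_of_opposite (he : IsDiamondAddressing (diamondGraph k) k e)
    {w : List (Bool × Bool)} {n : ℕ} (hn : w.length + n + 1 = k) {b c : Bool}
    {x y : DiamondVertex k} (hx : x ∈ addressRegion e k ((b, c) :: w))
    (hy : y ∈ addressRegion e k ((!b, !c) :: w)) : (2 : ℝ) ^ n ≤ dist x y := by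
  obtain ⟨φ, hφ, h0, h1⟩ := he.opposite w n hn b c
  have := abs_sub_le_dist_of_lipschitz hφ x y
  rw [h0 x hx, h1 y hy] at this
  simpa using this

theorem dist_ends_le (he : IsDiamondAddressing (diamondGraph k) k e) (n : ℕ) :
    ∀ w : List (Bool × Bool), w.length + n = k → dist (e w).1 (e w).2 ≤ 2 ^ n := by
  induction n with
  | zero => intro w hw; rw [DiamondVertex.dist_eq_one (he.adj w hw), pow_zero]
  | succ n ih =>
    intro w hw
    have hlt : w.length < k := by omega
    have h1 := ih ((false, false) :: w) (by simp; omega)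
    have h2 := ih ((false, true) :: w) (by simp; omega)
    rw [he.fst w hlt, he.mid w hlt] at h1
    rw [he.snd w hlt] at h2
    rw [pow_succ]
    linarith [dist_triangle (e w).1 (e ((false, true) :: w)).1 (e w).2]

/-- Both ends of an edge of the `n`-th subdivision are close to the first end of any edge under
it. -/
theorem dist_le_of_append (he : IsDiamondAddressing (diamondGraph k) k e) (u : List (Bool × Bool)) :
    ∀ w : List (Bool × Bool), (u ++ w).length = k →
      dist (e (u ++ w)).1 (e w).1 ≤ 2 ^ u.length ∧ dist (e (u ++ w)).1 (e w).2 ≤ 2 ^ u.length := by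
  induction u using List.reverseRecOn with
  | nil =>
    intro w hw
    have := DiamondVertex.dist_eq_one (he.adj w hw)
    simp [this]
  | append_singleton u l ih =>
    obtain ⟨b, c⟩ := l
    intro w hw
    rw [List.append_assoc, List.singleton_append] at hw ⊢
    obtain ⟨h1, h2⟩ := ih _ hw
    have hlen : u.length + w.length + 1 = k := by simpa [add_assoc] using hw
    have hlt : w.length < k := by omega
    have hpos : (0 : ℝ) < 2 ^ u.length := by positivity
    have e1 := he.dist_ends_le u.length ((b, false) :: w) (by simp; omega)
    have e2 := he.dist_ends_le u.length ((b, true) :: w) (by simp; omega)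
    rw [he.fst w hlt, he.mid w hlt] at e1
    rw [he.snd w hlt] at e2
    rw [List.length_append, List.length_singleton, pow_succ]
    cases c
    · rw [he.fst w hlt] at h1
      rw [he.mid w hlt] at h2
      have := dist_triangle (e (u ++ (b, false) :: w)).1 (e ((b, true) :: w)).1 (e w).2
      exact ⟨by linarith, by linarith⟩
    · rw [he.snd w hlt] at h2
      rw [dist_comm] at e1
      have := dist_triangle (e (u ++ (b, true) :: w)).1 (e ((b, true) :: w)).1 (e w).1
      exact ⟨by linarith, by linarith⟩

end IsDiamondAddressing

/-! ### Stretched edges -/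

/-- `IsConnectedBy e f D r w`: the poles of the quadrilateral with address `w` are joined by a
chain of edges of its `r`-th subdivision whose images under `f` are shorter than `D`. -/
def IsConnectedBy {V : Type u} {T : Type v} [MetricSpace T] (e : List (Bool × Bool) → V × V)
    (f : V → T) (D : ℝ) : ℕ → List (Bool × Bool) → Prop
  | 0, w => dist (f (e w).1) (f (e w).2) < D
  | r + 1, w => ∃ b, ∀ c, IsConnectedBy e f D r ((b, c) :: w)

namespace IsDiamondAddressing

theorem chain_of_isConnectedBy {V : Type u} {T : Type v} [MetricSpace T] {G : SimpleGraph V}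
    {k : ℕ} {e : List (Bool × Bool) → V × V} (he : IsDiamondAddressing G k e) {f : V → T}
    {D : ℝ} (s : List (Bool × Bool)) (r : ℕ) :
    ∀ w, s <:+ w → w.length + r ≤ k → IsConnectedBy e f D r w →
      Relation.ReflTransGen (fun x y => x ∈ addressRegion e k s ∧ y ∈ addressRegion e k s ∧
        dist (f x) (f y) < D) (e w).1 (e w).2 := by
  induction r with
  | zero =>
    exact fun w hs hw h => .single ⟨⟨w, hs, hw, Or.inl rfl⟩, ⟨w, hs, hw, Or.inr rfl⟩, h⟩
  | succ r ih =>
    rintro w hs hw ⟨b, hb⟩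
    have hlt : w.length < k := by omega
    have h1 := ih _ (hs.trans (List.suffix_cons _ _)) (by simp; omega) (hb false)
    have h2 := ih _ (hs.trans (List.suffix_cons _ _)) (by simp; omega) (hb true)
    rw [he.fst w hlt, he.mid w hlt] at h1
    rw [he.snd w hlt] at h2
    exact h1.trans h2

/-- One of the four sides of every quadrilateral is cut by stretched edges. -/
theorem exists_not_isConnectedBy {k : ℕ}
    {e : List (Bool × Bool) → DiamondVertex k × DiamondVertex k}
    (he : IsDiamondAddressing (diamondGraph k) k e) {T : Type v} [MetricSpace T]
    (hT : IsTreeMetric T) {f : DiamondVertex k → T} (hf : NonContractive f) {n r : ℕ}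
    {w : List (Bool × Bool)} (hn : w.length + n + 1 = k) (hr : r ≤ n) :
    ∃ l, ¬ IsConnectedBy e f (2 ^ n) r (l :: w) := by
  by_contra! hc
  have hlt : w.length < k := by omega
  have hchain : ∀ b c, _ := fun b c => he.chain_of_isConnectedBy ((b, c) :: w) r ((b, c) :: w)
    List.suffix_rfl (by simp; omega) (hc (b, c))
  have hmem : ∀ b c, (e ((b, c) :: w)).1 ∈ addressRegion e k ((b, c) :: w) := fun b c =>
    ⟨_, List.suffix_rfl, by simp; omega, Or.inl rfl⟩
  -- Opposite sides are `2 ^ n` apart in the graph, hence also in the tree; four connected sides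
  -- would contradict this.
  have far : ∀ b c, ∀ x ∈ addressRegion e k ((b, c) :: w),
      ∀ y ∈ addressRegion e k ((!b, !c) :: w), ¬ dist (f x) (f y) < 2 ^ n :=
    fun b c x hx y hy => not_lt.2 ((he.le_dist_of_opposite hn hx hy).trans (hf x y))
  have m1 := hmem false false
  have m2 := hmem false true
  have m3 := hmem true false
  have m4 := hmem true true
  have c1 := hchain false false
  have c2 := hchain false true
  have c3 := hchain true false
  have c4 := hchain true true
  rw [he.fst w hlt] at m1 m3
  rw [he.fst w hlt, he.mid w hlt] at c1 c3
  rw [he.snd w hlt] at c2 c4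
  rcases hT.exists_opposite_close (by positivity : (0 : ℝ) < 2 ^ n) m1 m2 m3 m4 c1 c2 c3 c4 with
    ⟨x, hx, y, hy, h⟩ | ⟨x, hx, y, hy, h⟩
  · exact far false false x hx y hy h
  · exact far false true x hx y hy h

end IsDiamondAddressing

/-! ### Binary cuts in the tree of addresses -/

/-- All addresses of length `n`. -/
def addresses : ℕ → Finset (List (Bool × Bool))
  | 0 => {[]}
  | n + 1 => (addresses n ×ˢ Finset.univ).map
      ⟨fun p => p.2 :: p.1, fun p q h => by
        simp only [List.cons.injEq] at h
        exact Prod.ext h.2 h.1⟩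

theorem length_of_mem_addresses {n : ℕ} : ∀ {w}, w ∈ addresses n → w.length = n := by
  induction n with
  | zero => intro w hw; simp [addresses] at hw; simp [hw]
  | succ n ih =>
    intro w hw
    simp only [addresses, Finset.mem_map, Finset.mem_product] at hw
    obtain ⟨p, ⟨hp, -⟩, rfl⟩ := hw
    exact congrArg (· + 1) (ih hp)

theorem sum_addresses_succ {M : Type*} [AddCommMonoid M] (n : ℕ) (F : List (Bool × Bool) → M) :
    ∑ w ∈ addresses (n + 1), F w = ∑ w ∈ addresses n, ∑ l, F (l :: w) := by
  rw [addresses, Finset.sum_map, Finset.sum_product]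
  rfl

theorem card_addresses (n : ℕ) : (addresses n).card = 4 ^ n := by
  induction n with
  | zero => rfl
  | succ n ih => simp [addresses, ih, pow_succ]

/-- The number of letters that may follow a prefix of length `d` in a binary cut that starts at
level `i` and ends at level `i + a`. -/
def cutDegree (i a d : ℕ) : ℕ :=
  if d < i then 4 else if d = i then 1 else if d < i + a then 2 else 4

/-- The density of the prefixes of length `n` that are compatible with a binary cut. -/
noncomputable def cutDensity (i a n : ℕ) : ℝ :=
  if n ≤ i then 1 else (1 / 2) ^ (min (n - i) a + 1)

/-- There are four letters, so one more letter multiplies the surviving fraction by `cutDegree / 4`.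
-/
theorem cutDensity_succ {i a : ℕ} (ha : 1 ≤ a) (n : ℕ) :
    4 * cutDensity i a (n + 1) = cutDegree i a n * cutDensity i a n := by
  unfold cutDensity cutDegree
  rcases lt_trichotomy n i with h | h | h
  · simp [h, h.le, Nat.succ_le_of_lt h]
  · subst h
    simp [ha]
    norm_num
  · have h1 : ¬ n ≤ i := by omega
    have h2 : ¬ n + 1 ≤ i := by omega
    have h3 : ¬ n < i := by omega
    have h4 : n ≠ i := by omega
    by_cases h5 : n < i + a
    · simp only [h1, h2, h3, h4, h5, if_false, if_true]
      rw [min_eq_left (by omega), min_eq_left (by omega), show n + 1 - i = n - i + 1 by omega,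
        pow_succ _ (n - i + 1)]
      push_cast
      ring
    · simp only [h1, h2, h3, h4, h5, if_false]
      rw [min_eq_right (by omega), min_eq_right (by omega)]
      push_cast
      ring

/-- The addresses all of whose letters are allowed by `s`. -/
def IsAllowed (s : List (Bool × Bool) → Finset (Bool × Bool)) : List (Bool × Bool) → Prop
  | [] => True
  | l :: w => IsAllowed s w ∧ l ∈ s w

theorem card_filter_addresses_succ (s : List (Bool × Bool) → Finset (Bool × Bool))
    (P : List (Bool × Bool) → Prop) [DecidablePred P]
    [DecidablePred fun w => ∃ l v, w = l :: v ∧ P v ∧ l ∈ s v] (n : ℕ) :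
    ((addresses (n + 1)).filter fun w => ∃ l v, w = l :: v ∧ P v ∧ l ∈ s v).card =
      ∑ v ∈ (addresses n).filter P, (s v).card := by
  rw [Finset.card_filter, sum_addresses_succ, Finset.sum_filter]
  refine Finset.sum_congr rfl fun v _ => ?_
  by_cases h : P v <;> simp [h]

open Classical in
theorem card_isAllowed {s : List (Bool × Bool) → Finset (Bool × Bool)} {i a : ℕ} (ha : 1 ≤ a)
    (hs : ∀ v, (s v).card = cutDegree i a v.length) (n : ℕ) :
    (((addresses n).filter (IsAllowed s)).card : ℝ) = 4 ^ n * cutDensity i a n := by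
  induction n with
  | zero => simp [addresses, cutDensity, Finset.filter_singleton, IsAllowed]
  | succ n ih =>
    have h : (addresses (n + 1)).filter (IsAllowed s) =
        (addresses (n + 1)).filter fun w => ∃ l v, w = l :: v ∧ IsAllowed s v ∧ l ∈ s v := by
      refine Finset.filter_congr fun w hw => ?_
      rcases w with _ | ⟨l, w⟩
      · simpa using length_of_mem_addresses hw
      · simp [IsAllowed]
    rw [h, card_filter_addresses_succ]
    have h2 : ∑ v ∈ (addresses n).filter (IsAllowed s), (s v).card =
        ∑ v ∈ (addresses n).filter (IsAllowed s), cutDegree i a n :=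
      Finset.sum_congr rfl fun v hv => by
        rw [hs, length_of_mem_addresses (Finset.mem_filter.1 hv).1]
    rw [h2, Finset.sum_const, smul_eq_mul, Nat.cast_mul, ih, pow_succ]
    linear_combination (-4 ^ n : ℝ) * cutDensity_succ (i := i) ha n

-- Up to length `j` only the constraint of `s` is kept, and from there on only that of `t`. This
-- nearly independent bound suffices because `t` starts at level `j`.
open Classical in
theorem card_isAllowed_inter_le {s t : List (Bool × Bool) → Finset (Bool × Bool)} {i j a : ℕ}
    (ha : 1 ≤ a) (hs : ∀ v, (s v).card = cutDegree i a v.length)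
    (ht : ∀ v, (t v).card = cutDegree j a v.length) {n : ℕ} (hn : j ≤ n) :
    (((addresses n).filter fun w => IsAllowed s w ∧ IsAllowed t w).card : ℝ) ≤
      4 ^ n * (cutDensity i a j * cutDensity j a n) := by
  induction n, hn using Nat.le_induction with
  | base =>
    have h1 : cutDensity j a j = 1 := by simp [cutDensity]
    rw [h1, mul_one, ← card_isAllowed ha hs]
    have h2 : (addresses j).filter (fun w => IsAllowed s w ∧ IsAllowed t w) ⊆
        (addresses j).filter (IsAllowed s) :=
      Finset.monotone_filter_right _ fun w _ hw => hw.1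
    exact_mod_cast Finset.card_le_card h2
  | succ n hn ih =>
    have h : (addresses (n + 1)).filter (fun w => IsAllowed s w ∧ IsAllowed t w) ⊆
        (addresses (n + 1)).filter fun w => ∃ l v, w = l :: v ∧
          (IsAllowed s v ∧ IsAllowed t v) ∧ l ∈ t v := by
      refine Finset.monotone_filter_right _ fun w hw hst => ?_
      rcases w with _ | ⟨l, w⟩
      · simpa using length_of_mem_addresses hw
      · exact ⟨l, w, rfl, ⟨hst.1.1, hst.2.1⟩, hst.2.2⟩
    have h1 := Finset.card_le_card h
    rw [card_filter_addresses_succ] at h1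
    have h2 : ∑ v ∈ (addresses n).filter (fun w => IsAllowed s w ∧ IsAllowed t w), (t v).card =
        ∑ v ∈ (addresses n).filter (fun w => IsAllowed s w ∧ IsAllowed t w), cutDegree j a n :=
      Finset.sum_congr rfl fun v hv => by
        rw [ht, length_of_mem_addresses (Finset.mem_filter.1 hv).1]
    rw [h2, Finset.sum_const, smul_eq_mul] at h1
    have h3 : (((addresses (n + 1)).filter fun w => IsAllowed s w ∧ IsAllowed t w).card : ℝ) ≤
        (((addresses n).filter fun w => IsAllowed s w ∧ IsAllowed t w).card : ℝ) *
          cutDegree j a n := by exact_mod_cast h1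
    refine h3.trans ((mul_le_mul_of_nonneg_right ih (Nat.cast_nonneg _)).trans (le_of_eq ?_))
    rw [pow_succ]
    linear_combination (-4 ^ n * cutDensity i a j : ℝ) * cutDensity_succ (i := j) ha n

/-- The first term has a bounded sum over `i`; the second is so small that `2 ^ a` levels can be
afforded. -/
theorem cutDensity_le {i j a : ℕ} (hij : i < j) :
    cutDensity i a j ≤ (1 / 2) ^ (j - i + 1) + (1 / 2) ^ (a + 1) := by
  rw [cutDensity, if_neg (by omega)]
  rcases min_choice (j - i) a with h | h <;> rw [h]
  · exact le_add_of_nonneg_right (by positivity)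
  · exact le_add_of_nonneg_left (by positivity)

theorem cutDensity_of_le {i a n : ℕ} (ha : 1 ≤ a) (h : i + a ≤ n) :
    cutDensity i a n = (1 / 2) ^ (a + 1) := by
  rw [cutDensity, if_neg (by omega), min_eq_right (by omega)]

theorem sum_range_half_pow_le (m : ℕ) :
    ∑ i ∈ Finset.range m, (1 / 2 : ℝ) ^ (m - i + 1) ≤ 1 / 2 := by
  suffices h : ∑ i ∈ Finset.range m, (1 / 2 : ℝ) ^ (m - i + 1) = 1 / 2 - (1 / 2) ^ (m + 1) by
    rw [h]; exact sub_le_self _ (by positivity)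
  induction m with
  | zero => norm_num
  | succ m ih =>
    rw [Finset.sum_range_succ]
    have : ∑ i ∈ Finset.range m, (1 / 2 : ℝ) ^ (m + 1 - i + 1) =
        (1 / 2) * ∑ i ∈ Finset.range m, (1 / 2 : ℝ) ^ (m - i + 1) := by
      rw [Finset.mul_sum]
      refine Finset.sum_congr rfl fun i hi => ?_
      rw [show m + 1 - i + 1 = (m - i + 1) + 1 by have := Finset.mem_range.1 hi; omega, pow_succ']
    rw [this, ih, show m + 1 - m = 1 by omega, pow_succ _ (m + 1)]
    ring

open Classical in
/-- Binary cuts that start at `m` successive levels have a large union. -/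
theorem card_exists_isAllowed_ge {s : ℕ → List (Bool × Bool) → Finset (Bool × Bool)} {a n m : ℕ}
    (ha : 1 ≤ a) (hs : ∀ i < m, ∀ v, (s i v).card = cutDegree i a v.length)
    (hm : 2 * m ≤ 2 ^ a) (hn : m + a ≤ n) :
    (4 : ℝ) ^ n * (m * (1 / 2) ^ (a + 3)) ≤
      ((addresses n).filter fun w => ∃ i < m, IsAllowed (s i) w).card := by
  induction m with
  | zero => simp
  | succ m ih =>
    have ih := ih (fun i hi => hs i (by omega)) (by omega) (by omega)
    set A := (addresses n).filter fun w => ∃ i < m, IsAllowed (s i) w with hA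
    set B := (addresses n).filter (IsAllowed (s m)) with hB
    have hunion : (addresses n).filter (fun w => ∃ i < m + 1, IsAllowed (s i) w) = A ∪ B := by
      rw [hA, hB, ← Finset.filter_or]
      refine Finset.filter_congr fun w _ => ?_
      simp only [Nat.lt_succ_iff_lt_or_eq, or_and_right, exists_or, exists_eq_left]
    have hinter : ((A ∩ B).card : ℝ) ≤ ∑ i ∈ Finset.range m,
        (((addresses n).filter fun w => IsAllowed (s i) w ∧ IsAllowed (s m) w).card : ℝ) := by
      have : A ∩ B ⊆ (Finset.range m).biUnion fun i =>
          (addresses n).filter fun w => IsAllowed (s i) w ∧ IsAllowed (s m) w := by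
        intro w hw
        simp only [hA, hB, Finset.mem_inter, Finset.mem_filter] at hw
        obtain ⟨⟨h1, i, hi, h2⟩, -, h3⟩ := hw
        simp only [Finset.mem_biUnion, Finset.mem_range, Finset.mem_filter]
        exact ⟨i, hi, h1, h2, h3⟩
      exact_mod_cast (Finset.card_le_card this).trans Finset.card_biUnion_le
    have hBcard : (B.card : ℝ) = 4 ^ n * (1 / 2) ^ (a + 1) := by
      rw [hB, card_isAllowed ha (hs m (by omega)), cutDensity_of_le ha (by omega)]
    -- The factor is `1/2` from the geometric sum plus `1/4` from `hm`. Hence each new cut adds at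
    -- least a quarter of its density, which is `2 ^ (-(a + 3))`.
    have hle : ((A ∩ B).card : ℝ) ≤ 4 ^ n * (1 / 2) ^ (a + 1) * (3 / 4) := by
      refine hinter.trans ?_
      calc _ ≤ ∑ i ∈ Finset.range m, 4 ^ n * (1 / 2 : ℝ) ^ (a + 1) *
              ((1 / 2) ^ (m - i + 1) + (1 / 2) ^ (a + 1)) := by
            refine Finset.sum_le_sum fun i hi => ?_
            have hi := Finset.mem_range.1 hi
            refine (card_isAllowed_inter_le ha (hs i (by omega)) (hs m (by omega))
              (by omega)).trans ?_
            rw [cutDensity_of_le ha (by omega : m + a ≤ n), mul_assoc, mul_comm (cutDensity _ _ _)]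
            gcongr
            exact cutDensity_le hi
        _ ≤ _ := by
            rw [← Finset.mul_sum, Finset.sum_add_distrib, Finset.sum_const, Finset.card_range,
              nsmul_eq_mul]
            have h1 := sum_range_half_pow_le m
            have h2 : (m : ℝ) * (1 / 2) ^ (a + 1) ≤ 1 / 4 := by
              have : (2 * (m + 1 : ℕ) : ℝ) ≤ 2 ^ a := by exact_mod_cast hm
              push_cast at this
              have hp : (0 : ℝ) < (1 / 2) ^ (a + 1) := by positivity
              have h3 : (2 : ℝ) ^ a * (1 / 2) ^ (a + 1) = 1 / 2 := by
                rw [pow_succ, ← mul_assoc, ← mul_pow]; norm_num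
              nlinarith
            gcongr
            linarith
    have hsum : ((A ∪ B).card : ℝ) + (A ∩ B).card = A.card + B.card := by
      exact_mod_cast Finset.card_union_add_card_inter A B
    rw [hunion]
    have hp : (1 / 2 : ℝ) ^ (a + 1) = 4 * (1 / 2) ^ (a + 3) := by
      rw [pow_add _ a 3, pow_add _ a 1]; ring
    rw [hp] at hBcard hle
    push_cast
    nlinarith

/-! ### Large gradients at many vertices of the diamond graphs -/

theorem IsAllowed.of_append {s : List (Bool × Bool) → Finset (Bool × Bool)}
    {u v : List (Bool × Bool)} (h : IsAllowed s (u ++ v)) : IsAllowed s v := by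
  induction u with
  | nil => exact h
  | cons l u ih => exact ih h.1

/-- By the triangle inequality `f x` is at distance at least `D` from `f y` or from `f z`. -/
theorem le_maxGradient_of_le_dist {X : Type u} {Y : Type v} [MetricSpace X] [MetricSpace Y]
    (f : X → Y) {x y z : X} {r D : ℝ} (hr : 0 < r) (hD : 0 < D) (hy : dist x y ≤ r)
    (hz : dist x z ≤ r) (h : 2 * D ≤ dist (f y) (f z)) :
    ENNReal.ofReal (D / r) ≤ maxGradient f x := by
  have key : ∀ y, dist x y ≤ r → D ≤ dist (f x) (f y) →
      ENNReal.ofReal (D / r) ≤ maxGradient f x := by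
    intro y hy h
    have hne : y ≠ x := by
      rintro rfl
      rw [dist_self] at h
      linarith
    refine le_trans ?_ (le_iSup₂ (f := fun y (_ : y ≠ x) => edist (f x) (f y) / edist x y) y hne)
    rw [ENNReal.ofReal_div_of_pos hr, edist_dist, edist_dist]
    gcongr
  rcases le_or_gt D (dist (f x) (f y)) with h' | h'
  · exact key y hy h'
  · exact key z hz (by linarith [dist_triangle_left (f y) (f z) (f x)])

theorem one_le_maxGradient {X : Type u} {Y : Type v} [MetricSpace X] [MetricSpace Y]
    {f : X → Y} (hf : NonContractive f) {x y : X} (h : y ≠ x) : 1 ≤ maxGradient f x := by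
  have hpos : 0 < dist x y := dist_pos.2 h.symm
  refine le_trans ?_ (le_iSup₂ (f := fun y (_ : y ≠ x) => edist (f x) (f y) / edist x y) y h)
  rw [ENNReal.le_div_iff_mul_le (Or.inl (by simpa using h.symm)) (Or.inl (edist_ne_top _ _)),
    one_mul, edist_dist, edist_dist]
  exact ENNReal.ofReal_le_ofReal (hf x y)

/-- One step of the construction of a binary cut: at level `i` a single disconnected side is kept,
and below it one disconnected half `γ b` of each parallel route `b`. Outside the levels of the cut
all letters are free. -/
theorem exists_finset_of_cutDegree {V : Type u} {T : Type v} [MetricSpace T]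
    (e : List (Bool × Bool) → V × V) (f : V → T) (D : ℝ) (i a : ℕ) (v : List (Bool × Bool))
    (hv : v.length = i → ∃ l, ¬ IsConnectedBy e f D (a - 1) (l :: v)) :
    ∃ s : Finset (Bool × Bool), s.card = cutDegree i a v.length ∧
      (v.length = i → ∀ l ∈ s, ¬ IsConnectedBy e f D (a - 1) (l :: v)) ∧
      ∀ r, i < v.length → v.length + r + 1 = i + a → ¬ IsConnectedBy e f D (r + 1) v →
        ∀ l ∈ s, ¬ IsConnectedBy e f D r (l :: v) := by
  rcases lt_trichotomy v.length i with h | h | h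
  · exact ⟨Finset.univ, by simp [cutDegree, h], fun h' => by omega, fun r h' => by omega⟩
  · obtain ⟨l, hl⟩ := hv h
    exact ⟨{l}, by simp [cutDegree, h], fun _ => by simpa using hl, fun r h' => by omega⟩
  · by_cases h1 : v.length < i + a
    · obtain ⟨r, hr⟩ := Nat.exists_eq_add_of_lt h1
      have hcard : ∀ γ : Bool → Bool, (Finset.univ.image fun b => (b, γ b)).card = 2 := fun γ => by
        rw [Finset.card_image_of_injective _ fun b c hbc => (Prod.ext_iff.1 hbc).1]
        rfl
      have hdeg : cutDegree i a v.length = 2 := by simp [cutDegree, h1, h.not_gt, h.ne']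
      by_cases hc : IsConnectedBy e f D (r + 1) v
      -- A connected `v` is off the cut; an arbitrary choice keeps the cardinality uniform.
      · refine ⟨_, (hcard fun _ => false).trans hdeg.symm, fun h' => by omega,
          fun r' _ hr' hc' => ?_⟩
        obtain rfl : r' = r := by omega
        exact absurd hc hc'
      · have hc2 := hc
        simp only [IsConnectedBy, not_exists, not_forall] at hc2
        choose γ hγ using hc2
        refine ⟨_, (hcard γ).trans hdeg.symm, fun h' => by omega, fun r' _ hr' _ l hl => ?_⟩
        obtain rfl : r' = r := by omega
        obtain ⟨b, -, rfl⟩ := Finset.mem_image.1 hl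
        exact hγ b
    · exact ⟨Finset.univ, by simp [cutDegree, h1, h.not_gt, h.ne'], fun h' => by omega,
        fun r _ _ => by omega⟩

namespace IsDiamondAddressing

variable {k : ℕ} {e : List (Bool × Bool) → DiamondVertex k × DiamondVertex k} {T : Type v}
  [MetricSpace T] {f : DiamondVertex k → T}

/-- In every quadrilateral of level `i`, the edges of the `a`-th subdivision that are stretched to
a quarter of the length of the quadrilateral contain a binary cut. -/
theorem exists_cut (he : IsDiamondAddressing (diamondGraph k) k e) (hT : IsTreeMetric T)
    (hf : NonContractive f) {i a : ℕ} (ha : 1 ≤ a) (hia : i + a ≤ k) :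
    ∃ s : List (Bool × Bool) → Finset (Bool × Bool),
      (∀ v, (s v).card = cutDegree i a v.length) ∧
      ∀ v, v.length = i + a → IsAllowed s v →
        2 ^ (k - i - 1) ≤ dist (f (e v).1) (f (e v).2) := by
  choose s hs h0 h1 using fun v => exists_finset_of_cutDegree e f (2 ^ (k - i - 1)) i a v
    fun hv => he.exists_not_isConnectedBy hT hf (n := k - i - 1) (by omega) (by omega)
  have key : ∀ v r, i < v.length → v.length + r = i + a → IsAllowed s v →
      ¬ IsConnectedBy e f (2 ^ (k - i - 1)) r v := by
    intro v
    induction v with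
    | nil => intro r h; simp at h
    | cons l v ih =>
      intro r hi hr hv
      simp only [List.length_cons] at hi hr
      rcases Nat.lt_succ_iff_lt_or_eq.1 hi with h | h
      · exact h1 v r h (by omega) (ih (r + 1) h (by omega) hv.1) l hv.2
      · obtain rfl : r = a - 1 := by omega
        exact h0 v h.symm l hv.2
  exact ⟨s, hs, fun v hv hal => not_lt.1 (key v 0 (by omega) hv hal)⟩

/-- The vertex lies within `2 ^ (k - i - a)` of both ends of an edge stretched to at least `2 ^ (k -
i - 1)`. One end realises half of this stretch, so the gradient is at least `2 ^ (a - 2)`. -/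
theorem le_maxGradient_of_isAllowed (he : IsDiamondAddressing (diamondGraph k) k e) {i a : ℕ}
    (ha : 1 ≤ a) (hia : i + a ≤ k) {s : List (Bool × Bool) → Finset (Bool × Bool)}
    (hs : ∀ v, v.length = i + a → IsAllowed s v → 2 ^ (k - i - 1) ≤ dist (f (e v).1) (f (e v).2))
    {w : List (Bool × Bool)} (hw : w.length = k) (hal : IsAllowed s w) :
    2 ^ a ≤ 4 * maxGradient f (e w).1 := by
  have hsplit := List.take_append_drop (k - (i + a)) w
  set p := w.take (k - (i + a))
  set v := w.drop (k - (i + a)) with hv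
  have hvlen : v.length = i + a := by rw [hv, List.length_drop]; omega
  have hplen : p.length = k - (i + a) := by simp [p, hw]
  rw [← hsplit] at hal hw ⊢
  obtain ⟨h1, h2⟩ := he.dist_le_of_append p v hw
  have h3 := hs v hvlen hal.of_append
  have h4 := le_maxGradient_of_le_dist f (D := 2 ^ (k - i - 1) / 2) (by positivity) (by positivity)
    h1 h2 (by linarith)
  calc (2 : ℝ≥0∞) ^ a = 4 * ENNReal.ofReal (2 ^ (k - i - 1) / 2 / 2 ^ p.length) := by
        rw [hplen, show k - i - 1 = (k - (i + a)) + (a - 1) by omega, pow_add]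
        obtain ⟨b, rfl⟩ := Nat.exists_eq_add_of_le' ha
        rw [show (4 : ℝ≥0∞) = ENNReal.ofReal 4 by simp, ← ENNReal.ofReal_mul (by norm_num),
          show (2 : ℝ≥0∞) = ENNReal.ofReal 2 by simp, ← ENNReal.ofReal_pow (by norm_num)]
        congr 1
        have : (2 : ℝ) ^ (k - (i + (b + 1))) ≠ 0 := by positivity
        field_simp
        rw [Nat.add_sub_cancel, pow_succ]
        ring
    _ ≤ _ := by gcongr

end IsDiamondAddressing

/-- The sum is at most twice its largest term, so lower bounds for `G` at different dyadic scales
may be added up. -/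
theorem ENNReal.sum_two_pow_le {A : ℕ → Prop} [DecidablePred A] {G : ℝ≥0∞} (n : ℕ)
    (h : ∀ a < n, A a → 2 ^ a ≤ G) : ∑ a ∈ Finset.range n, (if A a then 2 ^ a else 0) ≤ 2 * G := by
  induction n with
  | zero => simp
  | succ n ih =>
    by_cases hn : A n
    · have h1 : ∑ a ∈ Finset.range (n + 1), (if A a then (2 : ℝ≥0∞) ^ a else 0) ≤
          ((∑ a ∈ Finset.range (n + 1), 2 ^ a : ℕ) : ℝ≥0∞) := by
        push_cast
        refine Finset.sum_le_sum fun a _ => ?_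
        split_ifs <;> simp
      have h2 : ∑ a ∈ Finset.range (n + 1), 2 ^ a ≤ 2 * 2 ^ n := by
        have := Nat.geomSum_eq (le_refl 2) (n + 1)
        rw [pow_succ] at this
        omega
      calc _ ≤ _ := h1
        _ ≤ ((2 * 2 ^ n : ℕ) : ℝ≥0∞) := by exact_mod_cast h2
        _ ≤ _ := by
          push_cast
          gcongr
          exact h n (by omega) hn
    · rw [Finset.sum_range_succ, if_neg hn, add_zero]
      exact ih fun a ha => h a (by omega)

open Classical in
/-- The sum of the maximum gradients over all edges of a diamond graph is large. -/
theorem IsDiamondAddressing.le_sum_maxGradient {k m : ℕ}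
    {e : List (Bool × Bool) → DiamondVertex k × DiamondVertex k} {T : Type v}
    [MetricSpace T] {f : DiamondVertex k → T}
    (he : IsDiamondAddressing (diamondGraph k) k e) (hT : IsTreeMetric T)
    (hf : NonContractive f) (hm : 4 * m ≤ k) :
    ((4 ^ k * m ^ 2 : ℕ) : ℝ≥0∞) ≤ 64 * ∑ w ∈ addresses k, maxGradient f (e w).1 := by
  choose! s hs hcut using fun i a (h : 1 ≤ a ∧ i + a ≤ k) => he.exists_cut hT hf h.1 h.2
  -- The depth `a = m + 1 + t` runs from `m + 1` to `2 * m`: large enough for `2 * m ≤ 2 ^ a`, and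
  -- small enough for `m + a ≤ 3 * m ≤ k`.
  let A : ℕ → List (Bool × Bool) → Prop := fun t w => ∃ i < m, IsAllowed (s i (m + 1 + t)) w
  have hpoint : ∀ w ∈ addresses k,
      ∑ t ∈ Finset.range m, (if A t w then (2 : ℝ≥0∞) ^ (m + 1 + t) else 0) ≤
        8 * maxGradient f (e w).1 := by
    intro w hw
    have h := ENNReal.sum_two_pow_le (A := fun a => m + 1 ≤ a ∧ A (a - (m + 1)) w)
      (G := 4 * maxGradient f (e w).1) (m + 1 + m) (by
        rintro a ha ⟨hma, i, hi, hal⟩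
        rw [Nat.add_sub_cancel' hma] at hal
        exact he.le_maxGradient_of_isAllowed (by omega) (by omega)
          (hcut i a ⟨by omega, by omega⟩) (length_of_mem_addresses hw) hal)
    rw [Finset.sum_range_add, ← mul_assoc] at h
    calc _ ≤ _ := by
          refine le_trans (le_of_eq ?_) (le_add_of_nonneg_left zero_le)
          exact Finset.sum_congr rfl fun t _ => by simp
      _ ≤ _ := h
      _ = _ := by norm_num
  have hcard : ∀ t ∈ Finset.range m,
      4 ^ k * m ≤ 2 ^ (m + 1 + t) * 8 * ((addresses k).filter (A t)).card := by
    intro t ht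
    have ht := Finset.mem_range.1 ht
    have h := card_exists_isAllowed_ge (s := fun i => s i (m + 1 + t)) (a := m + 1 + t) (n := k)
      (m := m) (by omega) (fun i hi v => hs i _ ⟨by omega, by omega⟩ v) (by
        have h1 := Nat.lt_two_pow_self (n := m)
        have h2 : 2 ^ (m + 1) ≤ 2 ^ (m + 1 + t) := Nat.pow_le_pow_right (by norm_num) (by omega)
        rw [pow_succ] at h2
        omega) (by omega)
    have h' : ((4 ^ k * m : ℕ) : ℝ) ≤
        ((2 ^ (m + 1 + t) * 8 * ((addresses k).filter (A t)).card : ℕ) : ℝ) := by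
      push_cast
      calc (4 : ℝ) ^ k * m
          = 2 ^ (m + 1 + t) * 8 * (4 ^ k * (m * (1 / 2) ^ (m + 1 + t + 3))) := by
            rw [pow_add _ (m + 1 + t) 3, one_div, inv_pow]
            field_simp
            norm_num
        _ ≤ _ := by gcongr
    exact_mod_cast h'
  calc ((4 ^ k * m ^ 2 : ℕ) : ℝ≥0∞) = ((∑ t ∈ Finset.range m, 4 ^ k * m : ℕ) : ℝ≥0∞) := by
        rw [Finset.sum_const, Finset.card_range, smul_eq_mul]
        congr 1
        ring
    _ ≤ ((∑ t ∈ Finset.range m,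
          2 ^ (m + 1 + t) * 8 * ((addresses k).filter (A t)).card : ℕ) : ℝ≥0∞) := by
        exact_mod_cast Finset.sum_le_sum hcard
    _ = 8 * ∑ w ∈ addresses k, ∑ t ∈ Finset.range m,
          (if A t w then (2 : ℝ≥0∞) ^ (m + 1 + t) else 0) := by
        rw [Finset.sum_comm, Finset.mul_sum]
        push_cast
        refine Finset.sum_congr rfl fun t _ => ?_
        rw [← Finset.sum_filter, Finset.sum_const, nsmul_eq_mul]
        ring
    _ ≤ 8 * ∑ w ∈ addresses k, 8 * maxGradient f (e w).1 := by
        gcongr with w hw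
        exact hpoint w hw
    _ = _ := by
        rw [← Finset.mul_sum, ← mul_assoc]
        norm_num

/-! ### Counting vertices and edges -/

/-- A new edge amounts to an old edge, one of its two new vertices and one of its two ends. The ends
are numbered by choosing a representative of the unordered pair. -/
theorem natCard_edgeSet_quadReplace {V : Type u} (G : SimpleGraph V) :
    Nat.card (quadReplace G).edgeSet = 4 * Nat.card G.edgeSet := by
  let pt : G.edgeSet → Bool → V := fun e c => bif c then e.1.out.1 else e.1.out.2
  have hpt : ∀ e, s(pt e true, pt e false) = e.1 := fun e => Quot.out_eq _
  have hmem : ∀ e c, pt e c ∈ e.1 := by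
    intro e c
    rw [← hpt e]
    cases c <;> simp
  have hne : ∀ e, pt e true ≠ pt e false := by
    intro e
    have := e.2
    rw [← hpt e] at this
    exact SimpleGraph.Adj.ne this
  let F : (G.edgeSet × Bool) × Bool → (quadReplace G).edgeSet := fun p =>
    ⟨s(Sum.inl (pt p.1.1 p.2), Sum.inr p.1), hmem p.1.1 p.2⟩
  have hF : Function.Bijective F := by
    constructor
    · rintro ⟨p, c⟩ ⟨q, d⟩ h
      have h' : s(Sum.inl (pt p.1 c), Sum.inr p) = s(Sum.inl (pt q.1 d), Sum.inr q) :=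
        congrArg Subtype.val h
      simp only [Sym2.eq_iff, Sum.inl.injEq, Sum.inr.injEq, reduceCtorEq, and_self,
        or_false] at h'
      obtain ⟨h1, rfl⟩ := h'
      have hcd : c = d := by
        have := hne p.1
        cases c <;> cases d <;> simp_all
      rw [hcd]
    · have key : ∀ (a : V) (p : G.edgeSet × Bool) (h : a ∈ p.1.1),
          ∃ q, (F q).1 = s(Sum.inl a, Sum.inr p) := by
        intro a p h
        rw [← hpt p.1, Sym2.mem_iff] at h
        rcases h with rfl | rfl
        · exact ⟨(p, true), rfl⟩
        · exact ⟨(p, false), rfl⟩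
      rintro ⟨e, he⟩
      induction e with
      | h x y =>
        rcases x with a | p <;> rcases y with b | q
        · exact he.elim
        · obtain ⟨r, hr⟩ := key a q he
          exact ⟨r, Subtype.ext hr⟩
        · obtain ⟨r, hr⟩ := key b p he
          exact ⟨r, Subtype.ext (hr.trans Sym2.eq_swap)⟩
        · exact he.elim
  rw [← Nat.card_eq_of_bijective F hF, Nat.card_prod, Nat.card_prod]
  simp
  ring

instance finite_diamondVertex (k : ℕ) : Finite (DiamondVertex k) := by
  induction k with
  | zero => exact inferInstanceAs (Finite Bool)
  | succ k ih =>
    have : Finite (diamondGraph k).edgeSet := inferInstance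
    exact inferInstanceAs (Finite (DiamondVertex k ⊕ ((diamondGraph k).edgeSet × Bool)))

theorem natCard_edgeSet_diamondGraph (k : ℕ) : Nat.card (diamondGraph k).edgeSet = 4 ^ k := by
  induction k with
  | zero =>
    have : Nat.card (⊤ : SimpleGraph Bool).edgeSet = 1 := by
      rw [Nat.card_eq_fintype_card, ← SimpleGraph.edgeFinset_card,
        SimpleGraph.card_edgeFinset_top_eq_card_choose_two]
      rfl
    exact this
  | succ k ih =>
    rw [pow_succ', ← ih]
    exact natCard_edgeSet_quadReplace (diamondGraph k)

theorem natCard_diamondVertex (k : ℕ) : 3 * Nat.card (DiamondVertex k) = 2 * 4 ^ k + 4 := by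
  induction k with
  | zero =>
    have : Nat.card (DiamondVertex 0) = 2 := by
      change Nat.card Bool = 2
      simp
    rw [this]
    rfl
  | succ k ih =>
    have : Nat.card (DiamondVertex (k + 1)) = Nat.card (DiamondVertex k) + 4 ^ k * 2 := by
      rw [← natCard_edgeSet_diamondGraph k]
      change Nat.card (DiamondVertex k ⊕ ((diamondGraph k).edgeSet × Bool)) = _
      rw [Nat.card_sum, Nat.card_prod]
      simp
    rw [this, pow_succ]
    omega

theorem log_natCard_diamondVertex_le {k : ℕ} (hk : 1 ≤ k) :
    Real.log (Nat.card (DiamondVertex k)) ≤ 2 * k := by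
  have h := natCard_diamondVertex k
  have h4 : 4 ^ 1 ≤ 4 ^ k := Nat.pow_le_pow_right (by norm_num) hk
  have hle : (Nat.card (DiamondVertex k) : ℝ) ≤ 4 ^ k := by
    have : Nat.card (DiamondVertex k) ≤ 4 ^ k := by omega
    exact_mod_cast this
  have hpos : (0 : ℝ) < Nat.card (DiamondVertex k) := by
    have : 0 < Nat.card (DiamondVertex k) := by omega
    exact_mod_cast this
  have hlog : Real.log 4 ≤ 2 := by
    rw [show (4 : ℝ) = 2 ^ 2 by norm_num, Real.log_pow]
    push_cast
    linarith [Real.log_two_lt_d9]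
  have h1 := Real.log_le_log hpos hle
  rw [Real.log_pow] at h1
  have : (0 : ℝ) ≤ k := Nat.cast_nonneg k
  nlinarith

/-! ### The lower bound -/

theorem RandomEmbedding.measurable_maxGradient {X : Type u} [MetricSpace X] [Countable X]
    {P : ∀ (T : Type v) [MetricSpace T], Prop} (F : RandomEmbedding.{u, v, w} X P) (x : X) :
    Measurable fun ω => maxGradient (F.map ω) x := by
  unfold maxGradient
  refine Measurable.iSup fun y => Measurable.iSup fun _ => Measurable.div_const ?_ _
  simp only [edist_dist]
  exact (F.measurable_dist x y).ennreal_ofReal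

/-- The pointwise bound on the sum over all `4 ^ k` edges is integrated; some first end is at least
average. -/
theorem RandomEmbedding.exists_le_expectedMaxGradient_diamond {k m : ℕ} (hm : 4 * m ≤ k)
    (F : RandomEmbedding.{0, v, w} (DiamondVertex k) IsTreeMetric) :
    ∃ x, ((m ^ 2 : ℕ) : ℝ≥0∞) ≤ 64 * F.expectedMaxGradient x := by
  obtain ⟨e, he⟩ := exists_isDiamondAddressing k
  by_contra! hc
  have h1 : ((4 ^ k * m ^ 2 : ℕ) : ℝ≥0∞) ≤
      ∑ w ∈ addresses k, 64 * F.expectedMaxGradient (e w).1 := by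
    calc ((4 ^ k * m ^ 2 : ℕ) : ℝ≥0∞) = ∫⁻ _, ((4 ^ k * m ^ 2 : ℕ) : ℝ≥0∞) ∂F.prob := by simp
      _ ≤ ∫⁻ ω, 64 * ∑ w ∈ addresses k, maxGradient (F.map ω) (e w).1 ∂F.prob :=
          lintegral_mono fun ω => he.le_sum_maxGradient (F.target_mem ω) (F.nonContractive ω) hm
      _ = _ := by
          rw [lintegral_const_mul' _ _ (by simp),
            lintegral_finsetSum _ fun w _ => F.measurable_maxGradient _, Finset.mul_sum]
          rfl
  have hne : (addresses k).Nonempty := Finset.card_pos.1 (by rw [card_addresses]; positivity)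
  have h2 := ENNReal.sum_lt_sum_of_nonempty hne fun w _ => hc (e w).1
  rw [Finset.sum_const, card_addresses, nsmul_eq_mul] at h2
  exact absurd h1 (not_le.2 (by exact_mod_cast h2))

theorem RandomEmbedding.exists_le_expectedMaxGradient {k : ℕ} (hk : 1 ≤ k)
    (F : RandomEmbedding.{0, v, w} (DiamondVertex k) IsTreeMetric) :
    ∃ x, ENNReal.ofReal (1 / 16384 * Real.log (Nat.card (DiamondVertex k)) ^ 2) ≤
      F.expectedMaxGradient x := by
  have hlog := log_natCard_diamondVertex_le hk
  have hlog0 : 0 ≤ Real.log (Nat.card (DiamondVertex k)) := Real.log_natCast_nonneg _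
  -- For small `k` the trivial gradient bound 1 suffices, as the logarithm is at most 8. Otherwise
  -- `m = k / 4` gives a logarithm of at most `16 * m`, and `16 ^ 2 * 64 = 16384`.
  rcases lt_or_ge k 4 with h | h
  · have hnt : 1 < Nat.card (DiamondVertex k) := by have := natCard_diamondVertex k; omega
    have : Nontrivial (DiamondVertex k) := Finite.one_lt_card_iff_nontrivial.1 hnt
    obtain ⟨x, y, hxy⟩ := exists_pair_ne (DiamondVertex k)
    refine ⟨x, ?_⟩
    have hk' : (k : ℝ) ≤ 4 := by exact_mod_cast h.le
    calc _ ≤ ENNReal.ofReal 1 := ENNReal.ofReal_le_ofReal (by nlinarith)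
      _ = ∫⁻ _, 1 ∂F.prob := by simp
      _ ≤ _ := lintegral_mono fun ω => one_le_maxGradient (F.nonContractive ω) hxy.symm
  · obtain ⟨x, hx⟩ := F.exists_le_expectedMaxGradient_diamond (m := k / 4) (by omega)
    refine ⟨x, ?_⟩
    have hk' : (k : ℝ) ≤ 8 * (k / 4 : ℕ) := by
      have : k ≤ 8 * (k / 4) := by omega
      exact_mod_cast this
    have h1 : Real.log (Nat.card (DiamondVertex k)) ≤ 16 * (k / 4 : ℕ) := by linarith
    have h2 : 1 / 16384 * Real.log (Nat.card (DiamondVertex k)) ^ 2 ≤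
        ((k / 4) ^ 2 : ℕ) / 64 := by
      push_cast
      nlinarith
    calc _ ≤ ENNReal.ofReal (((k / 4) ^ 2 : ℕ) / 64) := ENNReal.ofReal_le_ofReal h2
      _ = ((k / 4) ^ 2 : ℕ) / 64 := by
          rw [ENNReal.ofReal_div_of_pos (by norm_num), ENNReal.ofReal_natCast]
          simp
      _ ≤ _ := ENNReal.div_le_of_le_mul' hx

/-! ### Ultrametrics from multiscale partitions -/

/-- The type `X`, to be equipped with the ultrametric whose value at `x`, `y` is `2 ^ (k + 1)` for
the largest `k ∈ K` such that `x` and `y` lie in different classes of the partition `c k`. -/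
def PartitionSpace {X : Type u} (K : Finset ℤ) (c : ℤ → X → X)
    (_ : ∀ x y, x ≠ y → ∃ k ∈ K, c k x ≠ c k y) : Type u := X

section PartitionSpace

variable {X : Type u} {K : Finset ℤ} {c : ℤ → X → X}
  {h : ∀ x y, x ≠ y → ∃ k ∈ K, c k x ≠ c k y}

open Classical in
/-- The ultrametric of a family of partitions. -/
noncomputable def partitionDist (K : Finset ℤ) (c : ℤ → X → X) (x y : X) : NNReal :=
  K.sup fun k => if c k x = c k y then 0 else 2 ^ (k + 1)

theorem le_partitionDist {x y : X} {k : ℤ} (hk : k ∈ K) (hc : c k x ≠ c k y) :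
    2 ^ (k + 1) ≤ partitionDist K c x y := by
  classical
  have := Finset.le_sup (f := fun k => if c k x = c k y then (0 : NNReal) else 2 ^ (k + 1)) hk
  rwa [if_neg hc] at this

theorem partitionDist_le {x y : X} {B : NNReal} (hB : ∀ k ∈ K, c k x ≠ c k y → 2 ^ (k + 1) ≤ B) :
    partitionDist K c x y ≤ B := by
  classical
  refine Finset.sup_le fun k hk => ?_
  split_ifs with hc
  · exact zero_le
  · exact hB k hk hc

theorem partitionDist_ultra (x y z : X) :
    partitionDist K c x z ≤ max (partitionDist K c x y) (partitionDist K c y z) := by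
  refine partitionDist_le fun k hk hc => ?_
  by_cases hxy : c k x = c k y
  · exact le_max_of_le_right (le_partitionDist hk (hxy ▸ hc))
  · exact le_max_of_le_left (le_partitionDist hk hxy)

noncomputable instance : MetricSpace (PartitionSpace K c h) where
  dist x y := partitionDist K c x y
  dist_self x := by
    have : partitionDist K c x x ≤ 0 := partitionDist_le fun k _ hc => absurd rfl hc
    exact_mod_cast le_antisymm this zero_le
  dist_comm x y := by
    have key : ∀ x y : X, partitionDist K c x y ≤ partitionDist K c y x := fun x y =>
      partitionDist_le fun k hk hc => le_partitionDist hk hc.symm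
    exact_mod_cast le_antisymm (key x y) (key y x)
  dist_triangle x y z := by
    have := (partitionDist_ultra (K := K) (c := c) x y z).trans
      (max_le_add_of_nonneg zero_le zero_le)
    exact_mod_cast this
  eq_of_dist_eq_zero {x y} hxy := by
    by_contra hne
    obtain ⟨k, hk, hc⟩ := h x y hne
    have h1 := le_partitionDist hk hc
    have h2 : partitionDist K c x y = 0 := by exact_mod_cast hxy
    rw [h2] at h1
    exact absurd h1 (not_le.2 (by positivity))

theorem isUltrametric_partitionSpace : IsUltrametric (PartitionSpace K c h) := fun x y z => by
  have := partitionDist_ultra (K := K) (c := c) x z y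
  exact_mod_cast this

/-- The identity, as a map to `PartitionSpace`. -/
def toPartitionSpace (h : ∀ x y, x ≠ y → ∃ k ∈ K, c k x ≠ c k y) : X → PartitionSpace K c h := id

theorem dist_toPartitionSpace (x y : X) :
    dist (toPartitionSpace h x) (toPartitionSpace h y) = partitionDist K c x y := rfl

end PartitionSpace

/-! ### Random partitions -/

/-- The points of a finite metric space are assigned to the first centre at distance at most
`R`. -/
theorem exists_center {X : Type u} [MetricSpace X] [Finite X] {n : ℕ} (σ : X → Fin n) {R : ℝ}
    (hR : 0 ≤ R) : ∃ c : X → X, ∀ x, dist (c x) x ≤ R ∧ ∀ z, dist z x ≤ R → σ (c x) ≤ σ z := by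
  have h : ∀ x : X, ∃ z, dist z x ≤ R ∧ ∀ w, dist w x ≤ R → σ z ≤ σ w := fun x => by
    obtain ⟨z, hz, hmin⟩ := Set.exists_min_image {z | dist z x ≤ R} σ (Set.toFinite _)
      ⟨x, by simpa using hR⟩
    exact ⟨z, hz, hmin⟩
  choose c hc using h
  exact ⟨c, hc⟩

/-- If nearby points are assigned to different centres, then the first point of some ball around
one of them lies at distance about `R` from it. -/
theorem exists_first_of_center_ne {X : Type u} [MetricSpace X] [Finite X] {n : ℕ} {σ : X → Fin n}
    (hσ : Function.Injective σ) {R r : ℝ} (hR : 0 ≤ R) {c : X → X}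
    (hc : ∀ x, dist (c x) x ≤ R ∧ ∀ z, dist z x ≤ R → σ (c x) ≤ σ z) {x y : X}
    (hxy : dist x y ≤ r) (hne : c x ≠ c y) :
    ∃ z, |dist z x - R| ≤ r ∧ ∀ w, dist w x ≤ dist z x → σ z ≤ σ w := by
  have hr : 0 ≤ r := dist_nonneg.trans hxy
  -- Let `z` be the first point of the ball of radius `R + r`, which contains every candidate centre
  -- of `x` and `y`. Were `z` closer to `x` than `R - r`, both points would choose it.
  obtain ⟨z, hz, hmin⟩ := Set.exists_min_image {z | dist z x ≤ R + r} σ (Set.toFinite _)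
    ⟨x, by simp; linarith⟩
  simp only [Set.mem_ofPred_eq] at hz hmin
  refine ⟨z, abs_le.2 ⟨?_, by linarith⟩, fun w hw => hmin w (hw.trans hz)⟩
  by_contra! hlt
  refine hne ?_
  have key : ∀ t, dist x t ≤ r → c t = z := fun t ht => by
    refine hσ (le_antisymm ((hc t).2 z ?_) (hmin _ ?_))
    · linarith [dist_triangle z x t]
    · linarith [dist_triangle_right (c t) x t, (hc t).1]
  rw [key x (by simpa using hr), key y hxy]

theorem card_le_of_forall_le_add {S : Finset ℕ} {m : ℕ} (h : ∀ i ∈ S, ∀ j ∈ S, j ≤ i + m) :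
    S.card ≤ m + 1 := by
  rcases S.eq_empty_or_nonempty with rfl | hS
  · simp
  · have : S ⊆ Finset.Icc (S.min' hS) (S.min' hS + m) := fun i hi =>
      Finset.mem_Icc.2 ⟨S.min'_le i hi, h _ (S.min'_mem hS) i hi⟩
    refine (Finset.card_le_card this).trans ?_
    rw [Nat.card_Icc]
    omega

/-- For one of the radii `(1 + i / 2 ^ J) * 2 ^ (k - 2)`, the distance `d` differs from the radius
by at most the `2 ^ (3 - j)`-th part of `2 ^ (k - 2)`. -/
def IsNearRadius (J i : ℕ) (d : ℝ) (j : ℕ) : Prop :=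
  ∃ k : ℤ, |d - (1 + i / 2 ^ J) * 2 ^ (k - 2)| ≤ 2 ^ (k + 1 - j)

theorem card_near_le (J j : ℕ) (hj : j ≤ J) (d : ℝ) (k : ℤ) {S : Finset ℕ}
    (hS : ∀ i ∈ S, |d - (1 + i / 2 ^ J) * (2 : ℝ) ^ (k - 2)| ≤ 2 ^ (k + 1 - j)) :
    S.card ≤ 16 * 2 ^ (J - j) + 1 := by
  refine card_le_of_forall_le_add fun i hi i' hi' => ?_
  have h1 := abs_le.1 (hS i hi)
  have h2 := abs_le.1 (hS i' hi')
  have hpos : (0 : ℝ) < 2 ^ (k - 2) := by positivity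
  have hJ : (0 : ℝ) < 2 ^ J := by positivity
  have e1 : (2 : ℝ) ^ (k + 1 - j : ℤ) * 2 ^ J = 8 * 2 ^ (J - j) * 2 ^ (k - 2) := by
    rw [← zpow_natCast, ← zpow_natCast, show (8 : ℝ) = 2 ^ (3 : ℤ) by norm_num,
      ← zpow_add₀ two_ne_zero, ← zpow_add₀ two_ne_zero, ← zpow_add₀ two_ne_zero]
    congr 1
    push_cast [hj]
    ring
  have e2 : ((i' : ℝ) - i) * 2 ^ (k - 2) ≤ 16 * 2 ^ (J - j) * 2 ^ (k - 2) := by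
    have e3 : ((i' : ℝ) / 2 ^ J - i / 2 ^ J) * 2 ^ (k - 2) ≤ 2 * 2 ^ (k + 1 - j : ℤ) := by
      linarith
    have e4 := mul_le_mul_of_nonneg_right e3 hJ.le
    rw [mul_assoc 2, e1] at e4
    calc _ = ((i' : ℝ) / 2 ^ J - i / 2 ^ J) * 2 ^ (k - 2) * 2 ^ J := by field_simp
      _ ≤ _ := e4
      _ = _ := by ring
  have e5 := le_of_mul_le_mul_right e2 hpos
  have e6 : (i' : ℝ) ≤ ((i + 16 * 2 ^ (J - j) : ℕ) : ℝ) := by push_cast; linarith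
  exact_mod_cast e6

open Classical in
/-- A given distance is close to a radius for few choices of the radii. -/
theorem card_isNearRadius_le {J j : ℕ} (h4 : 4 ≤ j) (hj : j ≤ J) (d : ℝ) :
    ((Finset.range (2 ^ J)).filter fun i => IsNearRadius J i d j).card ≤ 64 * 2 ^ (J - j) := by
  have hsub : ((Finset.range (2 ^ J)).filter fun i => IsNearRadius J i d j) ⊆
      (Finset.Icc (Int.log 2 d + 1) (Int.log 2 d + 3)).biUnion fun k =>
        (Finset.range (2 ^ J)).filter fun i : ℕ =>
          |d - (1 + i / 2 ^ J) * (2 : ℝ) ^ (k - 2)| ≤ 2 ^ (k + 1 - j) := by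
    intro i hi
    obtain ⟨hi, k, hk⟩ := Finset.mem_filter.1 hi
    -- As `4 ≤ j`, nearness at scale `k` puts `d` between `2 ^ (k - 3)` and `2 ^ k`, so only three
    -- scales matter. This is where sharing one factor among all scales pays off.
    refine Finset.mem_biUnion.2 ⟨k, ?_, Finset.mem_filter.2 ⟨hi, hk⟩⟩
    have hi : (i : ℝ) / 2 ^ J < 1 := by
      rw [div_lt_one (by positivity)]
      exact_mod_cast Finset.mem_range.1 hi
    have hi0 : (0 : ℝ) ≤ i / 2 ^ J := by positivity
    obtain ⟨h1, h2⟩ := abs_le.1 hk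
    have hpos : (0 : ℝ) < 2 ^ (k - 3) := by positivity
    have e1 : (2 : ℝ) ^ (k + 1 - j : ℤ) ≤ 2 ^ (k - 3) :=
      zpow_le_zpow_right₀ one_le_two (by omega)
    have e2 : (2 : ℝ) ^ (k - 2) = 2 * 2 ^ (k - 3) := by
      rw [← zpow_one_add₀ two_ne_zero]; congr 1; ring
    have e3 : (2 : ℝ) ^ k = 8 * 2 ^ (k - 3) := by
      rw [show (8 : ℝ) = 2 ^ (3 : ℤ) by norm_num, ← zpow_add₀ two_ne_zero]; congr 1; ring
    rw [e2] at h1 h2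
    have l1 : (2 : ℝ) ^ (k - 3) ≤ d := by nlinarith
    have l2 : d < (2 : ℝ) ^ k := by rw [e3]; nlinarith
    have hdpos : 0 < d := hpos.trans_le l1
    have m1 : k - 3 ≤ Int.log 2 d := (Int.zpow_le_iff_le_log one_lt_two hdpos).1 (by simpa using l1)
    have m2 : Int.log 2 d < k := (Int.lt_zpow_iff_log_lt one_lt_two hdpos).1 (by simpa using l2)
    exact Finset.mem_Icc.2 ⟨by omega, by omega⟩
  calc _ ≤ _ := Finset.card_le_card hsub
    _ ≤ _ := Finset.card_biUnion_le
    _ ≤ ∑ k ∈ Finset.Icc (Int.log 2 d + 1) (Int.log 2 d + 3), (16 * 2 ^ (J - j) + 1) :=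
        Finset.sum_le_sum fun k _ => card_near_le J j hj d k fun i hi => (Finset.mem_filter.1 hi).2
    _ ≤ _ := by
        rw [Finset.sum_const, Int.card_Icc, smul_eq_mul,
          show (Int.log 2 d + 3 + 1 - (Int.log 2 d + 1)).toNat = 3 by omega]
        have := Nat.one_le_two_pow (n := J - j)
        omega

open Classical in
/-- In a uniformly random ordering, each of the elements of `S` is equally likely to be the
first. -/
theorem card_first_mul_card_le {X : Type u} [Fintype X] (n : ℕ) {S : Finset X} {z : X}
    (hz : z ∈ S) :
    (Finset.univ.filter fun σ : X ≃ Fin n => ∀ w ∈ S, σ z ≤ σ w).card * S.card ≤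
      Fintype.card (X ≃ Fin n) := by
  have hdisj : (S : Set X).PairwiseDisjoint fun z =>
      Finset.univ.filter fun σ : X ≃ Fin n => ∀ w ∈ S, σ z ≤ σ w := by
    intro a ha b hb hab
    refine Finset.disjoint_left.2 fun σ hσa hσb => hab (σ.injective (le_antisymm ?_ ?_))
    · exact (Finset.mem_filter.1 hσa).2 b hb
    · exact (Finset.mem_filter.1 hσb).2 a ha
  have heq : ∀ a ∈ S, (Finset.univ.filter fun σ : X ≃ Fin n => ∀ w ∈ S, σ z ≤ σ w).card ≤
      (Finset.univ.filter fun σ : X ≃ Fin n => ∀ w ∈ S, σ a ≤ σ w).card := by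
    intro a ha
    refine Finset.card_le_card_of_injOn (fun σ => (Equiv.swap a z).trans σ) (fun σ hσ => ?_)
      fun σ _ τ _ h => ?_
    · simp only [Finset.coe_filter, Finset.mem_univ, true_and, Set.mem_ofPred_eq] at hσ ⊢
      intro w hw
      simp only [Equiv.trans_apply, Equiv.swap_apply_left]
      refine hσ _ ?_
      rw [Equiv.swap_apply_def]
      split_ifs <;> assumption
    · ext t
      have := DFunLike.congr_fun h (Equiv.swap a z t)
      simpa using congrArg Fin.val this
  calc _ = ∑ a ∈ S, (Finset.univ.filter fun σ : X ≃ Fin n => ∀ w ∈ S, σ z ≤ σ w).card := by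
        rw [Finset.sum_const, smul_eq_mul, mul_comm]
    _ ≤ _ := Finset.sum_le_sum heq
    _ = _ := (Finset.card_biUnion hdisj).symm
    _ ≤ _ := Finset.card_le_univ _

-- The `r`-th nearest point has at least `r` points in its ball. The induction adds the farthest
-- point, which contributes the last harmonic term.
open Classical in
theorem sum_inv_card_le_harmonic {X : Type u} (S : Finset X) (d : X → ℝ) :
    ∑ z ∈ S, ((S.filter fun w => d w ≤ d z).card : ℝ)⁻¹ ≤ (harmonic S.card : ℝ) := by
  induction S using Finset.induction_on_max_value d with
  | empty => simp
  | insert a s ha hmax ih =>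
    rw [Finset.sum_insert ha, Finset.card_insert_of_notMem ha, harmonic_succ]
    have h1 : (insert a s).filter (fun w => d w ≤ d a) = insert a s :=
      Finset.filter_true_of_mem fun w hw => by
        rcases Finset.mem_insert.1 hw with rfl | hw
        · exact le_rfl
        · exact hmax w hw
    have h2 : ∑ z ∈ s, (((insert a s).filter fun w => d w ≤ d z).card : ℝ)⁻¹ ≤
        ∑ z ∈ s, ((s.filter fun w => d w ≤ d z).card : ℝ)⁻¹ := by
      refine Finset.sum_le_sum fun z hz => inv_anti₀ ?_ ?_
      · have : 0 < (s.filter fun w => d w ≤ d z).card :=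
          Finset.card_pos.2 ⟨z, Finset.mem_filter.2 ⟨hz, le_rfl⟩⟩
        exact_mod_cast this
      · exact_mod_cast Finset.card_le_card (Finset.filter_subset_filter _ (Finset.subset_insert _ _))
    rw [h1, Finset.card_insert_of_notMem ha]
    push_cast
    linarith

/-! ### The random ultrametric -/

/-- Some point `z` at distance close to a radius from `x` is the first point, with respect to `σ`,
of the ball around `x` of radius `dist z x`. -/
def IsCutAt {X : Type u} [MetricSpace X] {n : ℕ} (σ : X ≃ Fin n) (J i : ℕ) (x : X) (j : ℕ) : Prop :=
  ∃ z, IsNearRadius J i (dist z x) j ∧ ∀ w, dist w x ≤ dist z x → σ z ≤ σ w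

open Classical in
/-- An ordering of the points and radii `(1 + i / 2 ^ J) * 2 ^ (k - 2)` determine an embedding into
an ultrametric space. -/
theorem exists_partition {X : Type u} [MetricSpace X] [Finite X] {n : ℕ} (σ : X ≃ Fin n)
    {J i : ℕ} (hi : i < 2 ^ J) :
    ∃ (K : Finset ℤ) (c : ℤ → X → X) (h : ∀ x y, x ≠ y → ∃ k ∈ K, c k x ≠ c k y),
      NonContractive (toPartitionSpace h) ∧
      ((∀ z x : X, ¬ IsNearRadius J i (dist z x) J) → ∀ x,
        maxGradient (toPartitionSpace h) x ≤ ENNReal.ofReal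
          (16 + ∑ j ∈ Finset.Ico 4 J, 2 ^ (j + 1) * (if IsCutAt σ J i x j then 1 else 0))) := by
  have : Fintype X := Fintype.ofFinite X
  have hi1 : (i : ℝ) / 2 ^ J < 1 := by
    rw [div_lt_one (by positivity)]
    exact_mod_cast hi
  have hi0 : (0 : ℝ) ≤ i / 2 ^ J := by positivity
  choose c hc using fun k : ℤ => exists_center σ
    (by positivity : (0 : ℝ) ≤ (1 + i / 2 ^ J) * 2 ^ (k - 2))
  -- Diagonal pairs only add the scale `Int.log 2 0 = 0`, which is harmless: the gradient bound
  -- holds at every scale.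
  let K : Finset ℤ := Finset.univ.image fun p : X × X => Int.log 2 (dist p.1 p.2)
  have hsep : ∀ x y, x ≠ y → c (Int.log 2 (dist x y)) x ≠ c (Int.log 2 (dist x y)) y := by
    intro x y hxy heq
    set k := Int.log 2 (dist x y)
    have h1 : (2 : ℝ) ^ k ≤ dist x y := by
      simpa using Int.zpow_log_le_self one_lt_two (dist_pos.2 hxy)
    have h2 := (hc k x).1
    have h3 := (hc k y).1
    rw [← heq] at h3
    have h4 := dist_triangle_left x y (c k x)
    have h5 : (2 : ℝ) ^ k = 4 * 2 ^ (k - 2) := by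
      rw [show (4 : ℝ) = 2 ^ (2 : ℤ) by norm_num, ← zpow_add₀ two_ne_zero]; congr 1; ring
    have h6 : (0 : ℝ) < 2 ^ (k - 2) := by positivity
    nlinarith
  have hK : ∀ x y : X, Int.log 2 (dist x y) ∈ K := fun x y =>
    Finset.mem_image.2 ⟨(x, y), Finset.mem_univ _, rfl⟩
  refine ⟨K, c, fun x y hxy => ⟨_, hK x y, hsep x y hxy⟩, fun x y => ?_, fun hgood x => ?_⟩
  · rw [dist_toPartitionSpace]
    rcases eq_or_ne x y with rfl | hxy
    · simp
    · have h1 := le_partitionDist (hK x y) (hsep x y hxy)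
      have h2 : dist x y < (2 : ℝ) ^ (Int.log 2 (dist x y) + 1) := by
        simpa using Int.lt_zpow_succ_log_self one_lt_two (dist x y)
      exact h2.le.trans (by exact_mod_cast h1)
  · refine iSup₂_le fun y hy => ?_
    have hpos : 0 < dist x y := dist_pos.2 hy.symm
    set B := 16 + ∑ j ∈ Finset.Ico 4 J, (2 : ℝ) ^ (j + 1) * (if IsCutAt σ J i x j then 1 else 0)
      with hB
    have hB16 : 16 ≤ B := le_add_of_nonneg_right (Finset.sum_nonneg fun j _ => by positivity)
    rw [edist_dist, edist_dist, ← ENNReal.ofReal_div_of_pos hpos, dist_toPartitionSpace]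
    refine ENNReal.ofReal_le_ofReal ((div_le_iff₀ hpos).2 ?_)
    have hBd : 0 ≤ B * dist x y := by positivity
    suffices h : partitionDist K c x y ≤ (B * dist x y).toNNReal by
      rw [← NNReal.coe_le_coe, Real.coe_toNNReal _ hBd] at h
      exact h
    refine partitionDist_le fun k hk hne => ?_
    suffices h : (2 : ℝ) ^ (k + 1) ≤ B * dist x y by
      rw [← NNReal.coe_le_coe, Real.coe_toNNReal _ hBd]
      push_cast
      exact h
    by_contra! hlt
    -- A stretch beyond `B` lies in a dyadic range `2 ^ j` to `2 ^ (j + 1)`. The summand 16 of `B`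
    -- forces `4 ≤ j`, good radii force `j < J`, and the separation makes `IsCutAt` hold at `j`, so
    -- `B` already contains `2 ^ (j + 1)`.
    have hρ : 16 < (2 : ℝ) ^ (k + 1) / dist x y := by
      rw [lt_div_iff₀ hpos]
      exact (mul_le_mul_of_nonneg_right hB16 hpos.le).trans_lt hlt
    obtain ⟨j, hj1, hj2⟩ := exists_nat_pow_near (by linarith : 1 ≤ (2 : ℝ) ^ (k + 1) / dist x y)
      one_lt_two
    have hj4 : 4 ≤ j := by
      by_contra! h
      have : (2 : ℝ) ^ (j + 1) ≤ 2 ^ 4 := pow_le_pow_right₀ one_le_two (by omega)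
      norm_num at this
      linarith
    have hdist : dist x y ≤ 2 ^ (k + 1 - j : ℤ) := by
      rw [le_div_iff₀ hpos] at hj1
      rw [zpow_sub₀ two_ne_zero, zpow_natCast, le_div_iff₀ (by positivity)]
      linarith
    obtain ⟨z, hz, hfirst⟩ := exists_first_of_center_ne σ.injective (by positivity) (hc k) hdist hne
    have hjJ : j < J := by
      by_contra! h
      refine hgood z x ⟨k, hz.trans (zpow_le_zpow_right₀ one_le_two ?_)⟩
      omega
    have hterm := Finset.single_le_sum (f := fun j => (2 : ℝ) ^ (j + 1) *
      (if IsCutAt σ J i x j then 1 else 0)) (fun j _ => by positivity) (Finset.mem_Ico.2 ⟨hj4, hjJ⟩)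
    rw [if_pos ⟨z, ⟨k, hz⟩, hfirst⟩, mul_one] at hterm
    rw [div_lt_iff₀ hpos] at hj2
    have : (2 : ℝ) ^ (j + 1) * dist x y ≤ B * dist x y := by gcongr; linarith
    linarith

open Classical in
/-- The choices of radii for which close points are never separated. -/
noncomputable def goodRadii (X : Type u) [MetricSpace X] (J : ℕ) : Finset (Fin (2 ^ J)) :=
  Finset.univ.filter fun i => ∀ z x : X, ¬ IsNearRadius J i (dist z x) J

theorem mem_goodRadii {X : Type u} [MetricSpace X] {J : ℕ} {i : Fin (2 ^ J)} :
    i ∈ goodRadii X J ↔ ∀ z x : X, ¬ IsNearRadius J i (dist z x) J := by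
  simp [goodRadii]

open Classical in
theorem card_isNearRadius_fin_le {J j : ℕ} (h4 : 4 ≤ j) (hj : j ≤ J) (d : ℝ) :
    (Finset.univ.filter fun i : Fin (2 ^ J) => IsNearRadius J i d j).card ≤ 64 * 2 ^ (J - j) := by
  refine le_trans (Finset.card_le_card_of_injOn Fin.val (fun i hi => ?_)
    Fin.val_injective.injOn) (card_isNearRadius_le h4 hj d)
  have := (Finset.mem_filter.1 hi).2
  simpa using this

/-- A union bound: each pair of points spoils at most 64 choices. -/
theorem two_pow_le_card_goodRadii (X : Type u) [MetricSpace X] [Fintype X] {J : ℕ} (h4 : 4 ≤ J)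
    (hJ : 128 * Fintype.card X ^ 2 ≤ 2 ^ J) : 2 ^ J ≤ 2 * (goodRadii X J).card := by
  classical
  have h1 : (goodRadii X J)ᶜ ⊆ (Finset.univ : Finset (X × X)).biUnion fun p =>
      Finset.univ.filter fun i : Fin (2 ^ J) => IsNearRadius J i (dist p.1 p.2) J := by
    intro i hi
    simp only [Finset.mem_compl, mem_goodRadii, not_forall, not_not] at hi
    obtain ⟨z, x, h⟩ := hi
    simp only [Finset.mem_biUnion, Finset.mem_univ, Finset.mem_filter, true_and]
    exact ⟨(z, x), h⟩
  have h2 := (Finset.card_le_card h1).trans (Finset.card_biUnion_le.trans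
    (Finset.sum_le_card_nsmul _ _ 64 fun p _ => by
      simpa using card_isNearRadius_fin_le h4 le_rfl (dist p.1 p.2)))
  rw [Finset.card_compl, Fintype.card_fin, Finset.card_univ, Fintype.card_prod, smul_eq_mul] at h2
  have h3 : (goodRadii X J).card ≤ 2 ^ J := by
    simpa using Finset.card_le_univ (goodRadii X J)
  rw [← sq] at h2
  omega

-- A union bound over `z`. The ordering and the radius vary independently, so the fractions
-- multiply: one over the size of the ball for being first, and `128 * 2 ^ (-j)` for the radius,
-- where restriction to good radii has cost a factor 2.
open Classical in
theorem card_isCutAt_le {X : Type u} [MetricSpace X] [Fintype X] (n : ℕ) {J : ℕ}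
    (hX : 128 * Fintype.card X ^ 2 ≤ 2 ^ J) (x : X) {j : ℕ} (h4 : 4 ≤ j) (hj : j ≤ J) :
    (2 : ℝ) ^ j * (Finset.univ.filter fun p : (X ≃ Fin n) × goodRadii X J =>
        IsCutAt p.1 J p.2 x j).card ≤
      128 * harmonic (Fintype.card X) * Fintype.card ((X ≃ Fin n) × goodRadii X J) := by
  have hN : (Fintype.card ((X ≃ Fin n) × goodRadii X J) : ℝ) =
      Fintype.card (X ≃ Fin n) * (goodRadii X J).card := by
    rw [Fintype.card_prod, Fintype.card_coe, Nat.cast_mul]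
  rw [hN]
  let S : X → Finset X := fun z => Finset.univ.filter fun w => dist w x ≤ dist z x
  let A : X → Finset (X ≃ Fin n) := fun z => Finset.univ.filter fun σ => ∀ w ∈ S z, σ z ≤ σ w
  let B : X → Finset (goodRadii X J) := fun z =>
    Finset.univ.filter fun i => IsNearRadius J i.1 (dist z x) j
  have hB : ∀ z, (2 : ℝ) ^ j * (B z).card ≤ 128 * (goodRadii X J).card := by
    intro z
    have h1 : (B z).card ≤ 64 * 2 ^ (J - j) := by
      refine le_trans (Finset.card_le_card_of_injOn Subtype.val (fun i hi => ?_)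
        Subtype.val_injective.injOn) (card_isNearRadius_fin_le h4 hj (dist z x))
      have := (Finset.mem_filter.1 hi).2
      simpa using this
    have h2 := two_pow_le_card_goodRadii X (h4.trans hj) hX
    have h3 : 2 ^ j * (B z).card ≤ 128 * (goodRadii X J).card := by
      calc 2 ^ j * (B z).card ≤ 2 ^ j * (64 * 2 ^ (J - j)) := Nat.mul_le_mul_left _ h1
        _ = 64 * 2 ^ J := by rw [mul_left_comm, ← pow_add, Nat.add_sub_cancel' hj]
        _ ≤ _ := by omega
    exact_mod_cast h3
  have hA : ∀ z, ((A z).card : ℝ) ≤ Fintype.card (X ≃ Fin n) * ((S z).card : ℝ)⁻¹ := by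
    intro z
    have hz : z ∈ S z := Finset.mem_filter.2 ⟨Finset.mem_univ _, le_rfl⟩
    have hpos : (0 : ℝ) < (S z).card := by exact_mod_cast Finset.card_pos.2 ⟨z, hz⟩
    rw [← div_eq_mul_inv, le_div_iff₀ hpos]
    exact_mod_cast card_first_mul_card_le n hz
  have hsub : (Finset.univ.filter fun p : (X ≃ Fin n) × goodRadii X J => IsCutAt p.1 J p.2 x j) ⊆
      Finset.univ.biUnion fun z => A z ×ˢ B z := by
    rintro ⟨σ, i⟩ hp
    obtain ⟨z, hz, hfirst⟩ := (Finset.mem_filter.1 hp).2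
    refine Finset.mem_biUnion.2 ⟨z, Finset.mem_univ _, Finset.mem_product.2 ⟨?_, ?_⟩⟩
    · exact Finset.mem_filter.2 ⟨Finset.mem_univ _, fun w hw =>
        hfirst w (Finset.mem_filter.1 hw).2⟩
    · exact Finset.mem_filter.2 ⟨Finset.mem_univ _, hz⟩
  have hcard : ((Finset.univ.filter fun p : (X ≃ Fin n) × goodRadii X J =>
      IsCutAt p.1 J p.2 x j).card : ℝ) ≤ ∑ z, ((A z).card : ℝ) * (B z).card := by
    have := (Finset.card_le_card hsub).trans Finset.card_biUnion_le
    simp only [Finset.card_product] at this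
    exact_mod_cast this
  calc _ ≤ (2 : ℝ) ^ j * ∑ z, ((A z).card : ℝ) * (B z).card := by gcongr
    _ = ∑ z, ((A z).card : ℝ) * (2 ^ j * (B z).card) := by
        rw [Finset.mul_sum]
        exact Finset.sum_congr rfl fun z _ => by ring
    _ ≤ ∑ z, (Fintype.card (X ≃ Fin n) * ((S z).card : ℝ)⁻¹) * (128 * (goodRadii X J).card) :=
        Finset.sum_le_sum fun z _ => mul_le_mul (hA z) (hB z) (by positivity) (by positivity)
    _ = 128 * (Fintype.card (X ≃ Fin n) * (goodRadii X J).card) * ∑ z, ((S z).card : ℝ)⁻¹ := by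
        rw [Finset.mul_sum]
        exact Finset.sum_congr rfl fun z _ => by ring
    _ ≤ 128 * (Fintype.card (X ≃ Fin n) * (goodRadii X J).card) * harmonic (Fintype.card X) := by
        gcongr
        have := sum_inv_card_le_harmonic (Finset.univ : Finset X) fun w => dist w x
        rwa [Finset.card_univ] at this
    _ = _ := by ring

/-- A uniformly distributed member of a finite family of embeddings into ultrametric spaces. -/
theorem exists_randomEmbedding_uniform {X : Type u} [MetricSpace X] (Ω : Type u) [Fintype Ω]
    [Nonempty Ω] {K : Ω → Finset ℤ} {c : Ω → ℤ → X → X}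
    (h : ∀ ω x y, x ≠ y → ∃ k ∈ K ω, c ω k x ≠ c ω k y)
    (hnc : ∀ ω, NonContractive (toPartitionSpace (h ω))) :
    ∃ F : RandomEmbedding.{u, u, u} X IsUltrametric, ∀ x : X, F.expectedMaxGradient x =
      ∑ ω, maxGradient (toPartitionSpace (h ω)) x * (Fintype.card Ω : ℝ≥0∞)⁻¹ := by
  let _ : MeasurableSpace Ω := ⊤
  have : DiscreteMeasurableSpace Ω := ⟨fun _ => trivial⟩
  refine ⟨{ Ω := Ω
            prob := (PMF.uniformOfFintype Ω).toMeasure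
            Target := fun ω => PartitionSpace (K ω) (c ω) (h ω)
            map := fun ω => toPartitionSpace (h ω)
            target_mem := fun _ => isUltrametric_partitionSpace
            nonContractive := hnc
            measurable_dist := fun _ _ => Measurable.of_discrete }, fun x => ?_⟩
  change ∫⁻ ω, maxGradient (toPartitionSpace (h ω)) x ∂(PMF.uniformOfFintype Ω).toMeasure = _
  rw [lintegral_fintype]
  refine Finset.sum_congr rfl fun ω _ => ?_
  rw [PMF.toMeasure_apply_singleton _ _ (MeasurableSet.of_discrete), PMF.uniformOfFintype_apply]

-- The weight `2 ^ (j + 1)` cancels the frequency of a cut, so every `j` contributes equally.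
open Classical in
theorem sum_isCutAt_le {X : Type u} [MetricSpace X] [Fintype X] (n : ℕ) {J : ℕ}
    (hJ : 128 * Fintype.card X ^ 2 ≤ 2 ^ J) (x : X) :
    ∑ p : (X ≃ Fin n) × goodRadii X J, (16 + ∑ j ∈ Finset.Ico 4 J,
        (2 : ℝ) ^ (j + 1) * (if IsCutAt p.1 J p.2 x j then 1 else 0)) ≤
      (16 + 256 * J * harmonic (Fintype.card X)) *
        Fintype.card ((X ≃ Fin n) × goodRadii X J) := by
  have hharm : (0 : ℝ) ≤ harmonic (Fintype.card X) := by
    exact_mod_cast Finset.sum_nonneg fun i _ => by positivity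
  have hterm : ∀ j ∈ Finset.Ico 4 J, ∑ p : (X ≃ Fin n) × goodRadii X J,
      (2 : ℝ) ^ (j + 1) * (if IsCutAt p.1 J p.2 x j then 1 else 0) ≤
        256 * harmonic (Fintype.card X) * Fintype.card ((X ≃ Fin n) × goodRadii X J) := by
    intro j hj
    have hj := Finset.mem_Ico.1 hj
    have h1 := card_isCutAt_le n hJ x hj.1 hj.2.le
    rw [← Finset.mul_sum, Finset.sum_boole, pow_succ]
    linarith
  rw [Finset.sum_add_distrib, Finset.sum_const, Finset.card_univ, nsmul_eq_mul, Finset.sum_comm]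
  have h1 := Finset.sum_le_card_nsmul _ _ _ hterm
  rw [Nat.card_Ico, nsmul_eq_mul] at h1
  have h2 : ((J - 4 : ℕ) : ℝ) ≤ J := by exact_mod_cast Nat.sub_le _ _
  have h3 := mul_le_mul_of_nonneg_right h2
    (by positivity : 0 ≤ 256 * (harmonic (Fintype.card X) : ℝ) *
      Fintype.card ((X ≃ Fin n) × goodRadii X J))
  linarith

theorem exists_randomEmbedding_ultrametric (X : Type u) [MetricSpace X] [Fintype X] {J : ℕ}
    (h4 : 4 ≤ J) (hJ : 128 * Fintype.card X ^ 2 ≤ 2 ^ J) :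
    ∃ F : RandomEmbedding.{u, u, u} X IsUltrametric, ∀ x : X,
      F.expectedMaxGradient x ≤ ENNReal.ofReal (16 + 256 * J * harmonic (Fintype.card X)) := by
  classical
  have hgood : (goodRadii X J).Nonempty := by
    have h1 := two_pow_le_card_goodRadii X h4 hJ
    have h2 : 0 < 2 ^ J := by positivity
    exact Finset.card_pos.1 (by omega)
  have : Nonempty (goodRadii X J) := hgood.to_subtype
  have : Nonempty (X ≃ Fin (Fintype.card X)) := ⟨Fintype.equivFin X⟩
  choose K c h hnc hgrad using
    fun ω : (X ≃ Fin (Fintype.card X)) × goodRadii X J => exists_partition ω.1 ω.2.1.2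
  obtain ⟨F, hF⟩ := exists_randomEmbedding_uniform _ h hnc
  refine ⟨F, fun x => ?_⟩
  have hsum := sum_isCutAt_le (Fintype.card X) hJ x
  have hcardpos : (0 : ℝ) < Fintype.card ((X ≃ Fin (Fintype.card X)) × goodRadii X J) := by
    exact_mod_cast Fintype.card_pos
  rw [hF x, ← Finset.sum_mul]
  refine le_trans ?_ (ENNReal.ofReal_le_ofReal ((div_le_iff₀ hcardpos).2 hsum))
  rw [ENNReal.ofReal_div_of_pos hcardpos, ENNReal.ofReal_natCast, div_eq_mul_inv]
  gcongr
  rw [ENNReal.ofReal_sum_of_nonneg fun ω _ => by positivity]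
  exact Finset.sum_le_sum fun ω _ => hgrad ω (mem_goodRadii.1 ω.2.2) x

theorem exists_randomEmbedding_log_sq (X : Type u) [MetricSpace X] [Finite X] :
    ∃ F : RandomEmbedding.{u, u, u} X IsUltrametric, ∀ x : X,
      F.expectedMaxGradient x ≤ ENNReal.ofReal (12000 * Real.log (Nat.card X) ^ 2) := by
  have : Fintype X := Fintype.ofFinite X
  rw [Nat.card_eq_fintype_card]
  set n := Fintype.card X
  -- The summand 7 accounts for `128 = 2 ^ 7`.
  set J := Nat.clog 2 (n ^ 2) + 7 with hJdef
  have hJ : 128 * n ^ 2 ≤ 2 ^ J := by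
    have := Nat.le_pow_clog one_lt_two (n ^ 2)
    rw [hJdef, pow_add]
    omega
  obtain ⟨F, hF⟩ := exists_randomEmbedding_ultrametric X (by omega) hJ
  refine ⟨F, fun x => ?_⟩
  rcases lt_or_ge 1 n with hn | hn
  · refine (hF x).trans (ENNReal.ofReal_le_ofReal ?_)
    set L := Real.log n
    have hharm : (harmonic n : ℝ) ≤ 1 + L := harmonic_le_one_add_log n
    have hl2 := Real.log_two_gt_d9
    have hL : Real.log 2 ≤ L := Real.log_le_log (by norm_num) (by exact_mod_cast hn)
    have hJL : (J : ℝ) * Real.log 2 ≤ 8 * Real.log 2 + 2 * L := by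
      have h1 : 2 ^ (J - 8) ≤ n ^ 2 := by
        have := Nat.pow_pred_clog_lt_self one_lt_two (x := n ^ 2) (by nlinarith)
        rw [show J - 8 = (Nat.clog 2 (n ^ 2)).pred by simp [hJdef]]
        exact this.le
      have h2 : (2 : ℝ) ^ (J - 8) ≤ (n : ℝ) ^ 2 := by exact_mod_cast h1
      have h3 := Real.log_le_log (by positivity) h2
      rw [Real.log_pow, Real.log_pow] at h3
      have h4 : (J : ℝ) ≤ (J - 8 : ℕ) + 8 := by exact_mod_cast (by omega : J ≤ J - 8 + 8)
      push_cast at h3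
      nlinarith
    -- The total is at most `16 + 256 * 15 * 3 * L ^ 2 = 16 + 11520 * L ^ 2`; since `L ≥ log 2`, the
    -- constant 12000 absorbs the 16.
    have hJ' : (J : ℝ) ≤ 15 * L := by nlinarith
    have hH' : (harmonic n : ℝ) ≤ 3 * L := by linarith
    have hJ0 : (0 : ℝ) ≤ J := Nat.cast_nonneg J
    have h1 : (J : ℝ) * harmonic n ≤ 15 * L * (3 * L) :=
      (mul_le_mul_of_nonneg_left hH' hJ0).trans (mul_le_mul_of_nonneg_right hJ' (by linarith))
    nlinarith
  · have : Subsingleton X := Fintype.card_le_one_iff_subsingleton.1 hn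
    have h0 : F.expectedMaxGradient x = 0 := by
      have : ∀ ω, maxGradient (F.map ω) x = 0 := fun ω => by
        refine le_antisymm (iSup₂_le fun y hy => ?_) zero_le
        exact absurd (Subsingleton.elim y x) hy
      simp [RandomEmbedding.expectedMaxGradient, this]
    rw [h0]
    exact zero_le

theorem theorem1p1 :
    (∃ C : ℝ, 0 < C ∧ ∀ (X : Type u) [MetricSpace X] [Finite X],
      ∃ F : RandomEmbedding.{u, u, u} X IsUltrametric, ∀ x : X,
        F.expectedMaxGradient x ≤ ENNReal.ofReal (C * Real.log (Nat.card X) ^ 2)) ∧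
    (∃ c : ℝ, 0 < c ∧ ∀ k : ℕ, 1 ≤ k →
      3 * Nat.card (DiamondVertex k) = 2 * 4 ^ k + 4 ∧
      ∀ F : RandomEmbedding.{0, v, w} (DiamondVertex k) IsTreeMetric,
        ∃ x : DiamondVertex k,
          ENNReal.ofReal (c * Real.log (Nat.card (DiamondVertex k)) ^ 2) ≤
            F.expectedMaxGradient x) := by
  exact ⟨⟨12000, by norm_num, fun X _ _ => exists_randomEmbedding_log_sq X⟩,
    1 / 16384, by norm_num, fun k hk =>
      ⟨natCard_diamondVertex k, fun F => F.exists_le_expectedMaxGradient hk⟩⟩
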